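/- Let $\epsilon_0\in(0,1)$. There exist constants $c_1,c_2>0$, depending only on $\epsilon_0$, such that the following holds for all $m,n\in\mathbb{N}$ with $m\ge c_1 n$ and every fixed $x\in\mathbb{C}^n$. Let $a_1,\dots,a_m$ be independent random vectors in $\mathbb{C}^n$ with distribution $\mathcal{N}(0,I_n/2)+i\,\mathcal{N}(0,I_n/2)$ (independent real and imaginary parts). Put $X=xx^*$ and $y=\mathcal{A}(X)\in\mathbb{R}^m$, where $\mathcal{A}(Z)=(\langle a_ka_k^*,Z\rangle)_{k=1}^m$ and $\langle A,B\rangle=\operatorname{tr}(AB)$, so that $y_k=|a_k^*x|^2$. Let $$Y=\frac1m\sum_{k=1}^m y_k\,a_ka_k^*\,\mathbb{1}_{\{y_k\le \frac3m\|y\|_1\}},\qquad z_0=\sqrt{\frac{n\|y\|_1}{\sum_{i=1}^m\|a_i\|_2^2}}\;\hat z,\qquad Z_0=z_0z_0^*,$$ where $\hat z$ is a leading eigenvector of $Y$, that is, a unit eigenvector for the largest eigenvalue of $Y$. Then, with probability at least $1-e^{-c_2m}$, $$\|Z_0-X\|_F\le\epsilon_0\|X\|_F$$ (for every choice of the leading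 eigenvector $\hat z$). -/

import Mathlib

open MeasureTheory ProbabilityTheory
open scoped NNReal Matrix Matrix.Norms.Frobenius

namespace PhaseRetrieval

/-- The rank-one Hermitian matrix `z z^*`. -/
def outer {n : ℕ} (z : EuclideanSpace ℂ (Fin n)) : Matrix (Fin n) (Fin n) ℂ :=
  Matrix.vecMulVec z.ofLp (star z.ofLp)

/-- The distribution `N(0, I_n/2) + i N(0, I_n/2)` on `ℂ^n`: the law of `u + i v`, where the real
vectors `u` and `v` are independent and have independent `N(0, 1/2)` coordinates. -/
noncomputable def complexGaussian (n : ℕ) : Measure (EuclideanSpace ℂ (Fin n)) :=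
  ((Measure.pi fun _ : Fin n => gaussianReal 0 (1 / 2 : ℝ≥0)).prod
    (Measure.pi fun _ : Fin n => gaussianReal 0 (1 / 2 : ℝ≥0))).map
      fun p => WithLp.toLp 2 fun j => (p.1 j : ℂ) + (p.2 j : ℂ) * Complex.I

/-- The vectors `a_1, …, a_m` are i.i.d. with law `N(0, I_n/2) + i N(0, I_n/2)`. -/
structure IsGaussianModel {Ω : Type*} [MeasurableSpace Ω] {m n : ℕ}
    (a : Fin m → Ω → EuclideanSpace ℂ (Fin n)) (μ : Measure Ω) : Prop where
  hasLaw : ∀ k, HasLaw (a k) (complexGaussian n) μ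
  indep : iIndepFun a μ

/-- The sampling operator `𝒜(Z) = (⟨a_k a_k^*, Z⟩)_k`, where `⟨A, B⟩ = tr (A B)`, which is real for
Hermitian `A` and `B`. -/
noncomputable def sampling {m n : ℕ} (a : Fin m → EuclideanSpace ℂ (Fin n))
    (Z : Matrix (Fin n) (Fin n) ℂ) : Fin m → ℝ :=
  fun k => ((outer (a k) * Z).trace).re

/-- The `ℓ_1`-norm of a real vector. -/
def l1Norm {m : ℕ} (y : Fin m → ℝ) : ℝ := ∑ k, |y k|

open Classical in
/-- The truncated matrix `Y = (1/m) ∑_k y_k a_k a_k^* 1{y_k ≤ (3/m) ‖y‖_1}`. -/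
noncomputable def truncatedMatrix {m n : ℕ} (a : Fin m → EuclideanSpace ℂ (Fin n))
    (y : Fin m → ℝ) : Matrix (Fin n) (Fin n) ℂ :=
  (1 / (m : ℂ)) •
    ∑ k, if y k ≤ 3 / (m : ℝ) * l1Norm y then (y k : ℂ) • outer (a k) else 0

/-- `v` is a leading eigenvector, normalized to unit length, of the (Hermitian) matrix `M`: an
eigenvector for the largest eigenvalue of `M`. -/
def IsLeadingEigenvector {n : ℕ} (M : Matrix (Fin n) (Fin n) ℂ)
    (v : EuclideanSpace ℂ (Fin n)) : Prop :=
  ‖v‖ = 1 ∧ ∃ l : ℝ, Module.End.HasEigenvector (Matrix.toEuclideanLin M) (l : ℂ) v ∧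
    ∀ l' : ℝ, Module.End.HasEigenvalue (Matrix.toEuclideanLin M) (l' : ℂ) → l' ≤ l

/-- `Z₀` is an output of the truncated spectral initialization with measurement vectors `a` and
data `y`: `Z₀ = z₀ z₀^*` with `z₀ = (n ‖y‖_1 / ∑_i ‖a_i‖_2^2)^{1/2} ẑ` for a unit leading
eigenvector `ẑ` of the truncated matrix. -/
def IsTruncatedSpectralInit {m n : ℕ} (a : Fin m → EuclideanSpace ℂ (Fin n)) (y : Fin m → ℝ)
    (Z₀ : Matrix (Fin n) (Fin n) ℂ) : Prop :=
  ∃ zhat : EuclideanSpace ℂ (Fin n), IsLeadingEigenvector (truncatedMatrix a y) zhat ∧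
    Z₀ = outer (((√(n * l1Norm y / ∑ i, ‖a i‖ ^ 2) : ℝ) : ℂ) • zhat)

theorem truncatedMatrix_isHermitian {m n : ℕ} (a : Fin m → EuclideanSpace ℂ (Fin n))
    (y : Fin m → ℝ) : (truncatedMatrix a y).IsHermitian := by
  have ho : ∀ z : EuclideanSpace ℂ (Fin n), (outer z).conjTranspose = outer z := by
    intro z
    simp [outer, Matrix.conjTranspose_vecMulVec]
  unfold truncatedMatrix Matrix.IsHermitian
  rw [Matrix.conjTranspose_smul, Matrix.conjTranspose_sum]
  congr 1
  · simp
  · refine Finset.sum_congr rfl fun k _ => ?_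
    split_ifs <;> simp [ho]

theorem exists_isLeadingEigenvector {n : ℕ} (hn : 0 < n) (M : Matrix (Fin n) (Fin n) ℂ)
    (hM : M.IsHermitian) : ∃ v, IsLeadingEigenvector M v := by
  have : Nonempty (Fin n) := ⟨⟨0, hn⟩⟩
  obtain ⟨i, hi⟩ := Finite.exists_max hM.eigenvalues
  refine ⟨hM.eigenvectorBasis i, hM.eigenvectorBasis.orthonormal.1 i, hM.eigenvalues i, ?_, ?_⟩
  · refine ⟨Module.End.mem_eigenspace_iff.2 ?_, ?_⟩
    · have := hM.mulVec_eigenvectorBasis i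
      ext j
      have := congrFun this j
      simpa [Matrix.toLpLin_apply] using this
    · exact hM.eigenvectorBasis.toBasis.ne_zero i |> fun h => by simpa using h
  · intro l' h
    have h3 : (l' : ℂ) ∈ spectrum ℂ M := by
      simpa [Matrix.spectrum_toLpLin] using h.mem_spectrum
    rw [hM.spectrum_eq_image_range] at h3
    obtain ⟨_, ⟨j, rfl⟩, hj⟩ := h3
    have : hM.eigenvalues j = l' := Complex.ofReal_injective hj
    exact this ▸ hi j

/-- The initialization is well defined: it always has an output (for `n ≥ 1`). -/
theorem exists_isTruncatedSpectralInit {m n : ℕ} (hn : 0 < n)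
    (a : Fin m → EuclideanSpace ℂ (Fin n)) (y : Fin m → ℝ) :
    ∃ Z₀, IsTruncatedSpectralInit a y Z₀ := by
  obtain ⟨v, hv⟩ := exists_isLeadingEigenvector hn _ (truncatedMatrix_isHermitian a y)
  exact ⟨_, v, hv, rfl⟩

end PhaseRetrieval

/-! Write `x = ‖x‖ u` with `‖u‖ = 1`. Truncation is positively homogeneous, so up to the factor
`‖x‖²` the quadratic form of `Y` at `v` is the empirical mean of `trunc τ (|u^* a_k|²) |v^* a_k|²`,
with a random threshold `τ` close to `3`. For a fixed threshold its expectation is `F |u^* v|² + G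
(1 - |u^* v|²)`, where `F` and `G` are the second and first truncated moments of an exponential
variable (`integral_trunc_mul_norm_inner_sq`). The gap `F - G` is at least `1/4` once the threshold
is at least `3` (`secondTruncMoment_sub_firstTruncMoment`), so `u` is the strict maximizer on
average.

Since a leading eigenvector `z` does at least as well as `u`, two one-sided estimates suffice: a
lower bound at the single vector `u` and an upper bound over the sphere, reduced to a finite net
(`one_sub_norm_inner_sq_le`). Monotonicity of the truncation in its threshold sandwiches the random
`τ` between the deterministic levels `3 (1 ± δ)`, which restores independence of the summands. The
scaling of `z₀` is right because `‖y‖_1` is near `m ‖x‖²` and `∑ ‖a_i‖²` is near `m n`.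

Each of these estimates fails with probability at most `exp (-c m)`, with `c` independent of `n`,
because every summand is dominated by `4 |v^* a_k|²`, whose law does not depend on `n`
(`exists_measureReal_le_exp`). The number of events is at most exponential in `n`, which `m ≥ c₁ n`
absorbs. -/

namespace PhaseRetrieval

/-! ### Marginals of the complex Gaussian vector -/

/-- The standard complex Gaussian distribution `N(0, 1/2) + i N(0, 1/2)`. -/
noncomputable def stdComplexGaussian : Measure ℂ :=
  ((gaussianReal 0 (1 / 2 : ℝ≥0)).prod (gaussianReal 0 (1 / 2 : ℝ≥0))).map
    fun p => (p.1 : ℂ) + (p.2 : ℂ) * Complex.I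

theorem measurable_ofReal_add_ofReal_mul_I :
    Measurable fun p : ℝ × ℝ => (p.1 : ℂ) + (p.2 : ℂ) * Complex.I := by fun_prop

theorem measurable_toLp_ofReal_add_ofReal_mul_I (n : ℕ) :
    Measurable fun p : (Fin n → ℝ) × (Fin n → ℝ) =>
      (WithLp.toLp 2 fun j => (p.1 j : ℂ) + (p.2 j : ℂ) * Complex.I :
        EuclideanSpace ℂ (Fin n)) := by fun_prop

instance : IsProbabilityMeasure stdComplexGaussian :=
  Measure.isProbabilityMeasure_map measurable_ofReal_add_ofReal_mul_I.aemeasurable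

instance (n : ℕ) : IsProbabilityMeasure (complexGaussian n) :=
  Measure.isProbabilityMeasure_map (measurable_toLp_ofReal_add_ofReal_mul_I n).aemeasurable

theorem integral_cexp_mul_gaussianReal (t : ℝ) :
    ∫ x, Complex.exp ((t * x : ℝ) * Complex.I) ∂gaussianReal 0 (1 / 2 : ℝ≥0) =
      Complex.exp (-(t ^ 2 / 4 : ℝ)) := by
  have h := charFun_gaussianReal (μ := 0) (v := (1 / 2 : ℝ≥0)) t
  rw [charFun_apply_real] at h
  push_cast at h
  push_cast
  rw [h]
  congr 1
  ring

/-- The answer depends on `z` only through its norm: this is unitary invariance, from which all one-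
and two-dimensional marginals are read off. -/
theorem integral_cexp_re_inner_complexGaussian {n : ℕ} (z : EuclideanSpace ℂ (Fin n)) :
    ∫ a, Complex.exp (((inner ℂ z a).re : ℝ) * Complex.I) ∂complexGaussian n =
      Complex.exp (-(‖z‖ ^ 2 / 4 : ℝ)) := by
  rw [complexGaussian, integral_map (measurable_toLp_ofReal_add_ofReal_mul_I n).aemeasurable
    (by fun_prop)]
  have h : ∀ p : (Fin n → ℝ) × (Fin n → ℝ),
      Complex.exp (((inner ℂ z (WithLp.toLp 2 fun j => (p.1 j : ℂ) + (p.2 j : ℂ) * Complex.I :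
        EuclideanSpace ℂ (Fin n))).re : ℝ) * Complex.I) =
      (∏ j, Complex.exp (((z j).re * p.1 j : ℝ) * Complex.I)) *
        ∏ j, Complex.exp (((z j).im * p.2 j : ℝ) * Complex.I) := by
    intro p
    rw [← Complex.exp_sum, ← Complex.exp_sum, ← Complex.exp_add, ← Finset.sum_mul,
      ← Finset.sum_mul, ← add_mul, ← Complex.ofReal_sum, ← Complex.ofReal_sum,
      ← Complex.ofReal_add, ← Finset.sum_add_distrib]
    congr 3
    rw [PiLp.inner_apply, Complex.re_sum]
    refine Finset.sum_congr rfl fun j _ => ?_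
    simp
    ring
  simp_rw [h]
  rw [integral_prod_mul (fun p : Fin n → ℝ => ∏ j, Complex.exp (((z j).re * p j : ℝ) * Complex.I))
    (fun p : Fin n → ℝ => ∏ j, Complex.exp (((z j).im * p j : ℝ) * Complex.I)),
    integral_fintype_prod_eq_prod (fun j (x : ℝ) => Complex.exp (((z j).re * x : ℝ) * Complex.I)),
    integral_fintype_prod_eq_prod (fun j (x : ℝ) => Complex.exp (((z j).im * x : ℝ) * Complex.I))]
  simp_rw [integral_cexp_mul_gaussianReal]
  rw [← Complex.exp_sum, ← Complex.exp_sum, ← Complex.exp_add]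
  congr 1
  rw [EuclideanSpace.norm_sq_eq, ← Finset.sum_add_distrib, Finset.sum_div, Complex.ofReal_sum,
    ← Finset.sum_neg_distrib]
  refine Finset.sum_congr rfl fun j _ => ?_
  rw [Complex.sq_norm, Complex.normSq_apply]
  push_cast
  ring

theorem charFun_stdComplexGaussian (t : ℂ) :
    charFun stdComplexGaussian t = Complex.exp (-(‖t‖ ^ 2 / 4 : ℝ)) := by
  rw [charFun_apply, stdComplexGaussian,
    integral_map measurable_ofReal_add_ofReal_mul_I.aemeasurable (by fun_prop)]
  have h : ∀ p : ℝ × ℝ,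
      Complex.exp ((inner ℝ ((p.1 : ℂ) + (p.2 : ℂ) * Complex.I) t : ℝ) * Complex.I) =
        Complex.exp ((t.re * p.1 : ℝ) * Complex.I) *
          Complex.exp ((t.im * p.2 : ℝ) * Complex.I) := by
    intro p
    rw [← Complex.exp_add, ← add_mul, ← Complex.ofReal_add, Complex.inner]
    congr 3
    simp
  simp_rw [h]
  rw [integral_prod_mul (fun x : ℝ => Complex.exp ((t.re * x : ℝ) * Complex.I))
    (fun x : ℝ => Complex.exp ((t.im * x : ℝ) * Complex.I)), integral_cexp_mul_gaussianReal,
    integral_cexp_mul_gaussianReal, ← Complex.exp_add]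
  congr 1
  rw [Complex.sq_norm, Complex.normSq_apply]
  push_cast
  ring

theorem map_inner_complexGaussian {n : ℕ} {u : EuclideanSpace ℂ (Fin n)} (hu : ‖u‖ = 1) :
    (complexGaussian n).map (fun a => inner ℂ u a) = stdComplexGaussian := by
  have : IsProbabilityMeasure ((complexGaussian n).map fun a => inner ℂ u a) :=
    Measure.isProbabilityMeasure_map (by fun_prop)
  refine Measure.ext_of_charFun (funext fun t => ?_)
  rw [charFun_stdComplexGaussian, charFun_apply, integral_map (by fun_prop) (by fun_prop)]
  have h := integral_cexp_re_inner_complexGaussian (t • u)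
  rw [norm_smul, hu, mul_one] at h
  rw [← h]
  refine integral_congr_ae (.of_forall fun a => ?_)
  simp only [Complex.inner, inner_smul_left]
  congr 3
  simp [-inner_conj_symm]

/-- By Pythagoras the exponent `‖t₁ u + t₂ w‖²` splits as `|t₁|² + |t₂|²`, so the joint
characteristic function factors, which is independence. -/
theorem map_inner_prodMk_inner_complexGaussian {n : ℕ} {u w : EuclideanSpace ℂ (Fin n)}
    (hu : ‖u‖ = 1) (hw : ‖w‖ = 1) (huw : inner ℂ u w = 0) :
    (complexGaussian n).map (fun a => (inner ℂ u a, inner ℂ w a)) =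
      stdComplexGaussian.prod stdComplexGaussian := by
  have hm : Measurable fun a : EuclideanSpace ℂ (Fin n) => (inner ℂ u a, inner ℂ w a) := by
    fun_prop
  have : IsProbabilityMeasure ((complexGaussian n).map fun a => (inner ℂ u a, inner ℂ w a)) :=
    Measure.isProbabilityMeasure_map hm.aemeasurable
  refine charFun_eq_prod_iff.1 fun t => ?_
  rw [charFun_stdComplexGaussian, charFun_stdComplexGaussian, charFun_apply,
    integral_map (by fun_prop) (by fun_prop), integral_map hm.aemeasurable (by fun_prop)]
  have h := integral_cexp_re_inner_complexGaussian ((WithLp.ofLp t).1 • u + (WithLp.ofLp t).2 • w)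
  have hn : ‖(WithLp.ofLp t).1 • u + (WithLp.ofLp t).2 • w‖ ^ 2 =
      ‖(WithLp.ofLp t).1‖ ^ 2 + ‖(WithLp.ofLp t).2‖ ^ 2 := by
    rw [sq, norm_add_sq_eq_norm_sq_add_norm_sq_of_inner_eq_zero (𝕜 := ℂ), norm_smul, norm_smul,
      hu, hw]
    · ring
    · simp [inner_smul_left, inner_smul_right, huw]
  rw [hn] at h
  rw [← Complex.exp_add, ← neg_add, ← Complex.ofReal_add, ← add_div, ← h]
  refine integral_congr_ae (.of_forall fun a => ?_)
  simp only [WithLp.prod_inner_apply, Complex.inner, inner_add_left, inner_smul_left]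
  congr 3
  simp [-inner_conj_symm]

instance : IsGaussian stdComplexGaussian := by
  have h : (fun p : ℝ × ℝ => (p.1 : ℂ) + (p.2 : ℂ) * Complex.I) =
      (Complex.equivRealProdCLM.symm : ℝ × ℝ →L[ℝ] ℂ) := by
    ext p
    simp [Complex.equivRealProdCLM_symm_apply]
  rw [stdComplexGaussian, h]
  infer_instance

/-! ### The exponential law of `|z|²` and its truncated moments -/

theorem gaussianReal_prod_gaussianReal_eq_withDensity :
    (gaussianReal 0 (1 / 2 : ℝ≥0)).prod (gaussianReal 0 (1 / 2 : ℝ≥0)) =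
      (volume : Measure (ℝ × ℝ)).withDensity
        fun p => gaussianPDF 0 (1 / 2) p.1 * gaussianPDF 0 (1 / 2) p.2 := by
  rw [gaussianReal_of_var_ne_zero _ (by norm_num), prod_withDensity (measurable_gaussianPDF _ _)
    (measurable_gaussianPDF _ _), Measure.volume_eq_prod]

theorem gaussianPDF_mul_gaussianPDF_toReal (x y : ℝ) :
    (gaussianPDF 0 (1 / 2) x * gaussianPDF 0 (1 / 2) y).toReal =
      Real.pi⁻¹ * Real.exp (-(x ^ 2 + y ^ 2)) := by
  have h : ∀ x : ℝ, (gaussianPDF 0 (1 / 2) x).toReal = (√Real.pi)⁻¹ * Real.exp (-x ^ 2) := by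
    intro x
    rw [toReal_gaussianPDF, gaussianPDFReal_def]
    simp [div_eq_mul_inv, mul_left_comm]
  rw [ENNReal.toReal_mul, h, h, neg_add, Real.exp_add]
  calc _ = (√Real.pi * √Real.pi)⁻¹ * (Real.exp (-x ^ 2) * Real.exp (-y ^ 2)) := by
        rw [mul_inv]; ring
    _ = _ := by rw [Real.mul_self_sqrt Real.pi_pos.le]

/-- The squared modulus of a standard complex Gaussian is exponentially distributed. -/
theorem integral_comp_norm_sq_stdComplexGaussian {f : ℝ → ℝ} (hf : Measurable f) :
    ∫ z, f (‖z‖ ^ 2) ∂stdComplexGaussian = ∫ t in Set.Ioi 0, Real.exp (-t) * f t := by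
  have hm : Measurable fun z : ℂ => f (‖z‖ ^ 2) := hf.comp (by fun_prop)
  rw [stdComplexGaussian, integral_map measurable_ofReal_add_ofReal_mul_I.aemeasurable
    hm.aestronglyMeasurable, gaussianReal_prod_gaussianReal_eq_withDensity,
    integral_withDensity_eq_integral_toReal_smul (by fun_prop)
      (.of_forall fun p => ENNReal.mul_lt_top gaussianPDF_lt_top gaussianPDF_lt_top),
    ← integral_comp_polarCoord_symm]
  have h : ∀ p : ℝ × ℝ, p.1 • ((gaussianPDF 0 (1 / 2) (polarCoord.symm p).1 *
        gaussianPDF 0 (1 / 2) (polarCoord.symm p).2).toReal •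
        f (‖((polarCoord.symm p).1 : ℂ) + ((polarCoord.symm p).2 : ℂ) * Complex.I‖ ^ 2)) =
      (p.1 * (Real.exp (-p.1 ^ 2) * f (p.1 ^ 2))) * Real.pi⁻¹ := by
    intro p
    have h2 : (p.1 * Real.cos p.2) ^ 2 + (p.1 * Real.sin p.2) ^ 2 = p.1 ^ 2 := by
      rw [mul_pow, mul_pow, ← mul_add, Real.cos_sq_add_sin_sq, mul_one]
    rw [gaussianPDF_mul_gaussianPDF_toReal, Complex.sq_norm, Complex.normSq_add_mul_I]
    simp only [polarCoord_symm_apply, h2, smul_eq_mul]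
    ring
  simp_rw [h]
  have ht : polarCoord.target = Set.Ioi (0 : ℝ) ×ˢ Set.Ioo (-Real.pi) Real.pi := rfl
  rw [ht, Measure.volume_eq_prod,
    setIntegral_prod_mul (fun r : ℝ => r * (Real.exp (-r ^ 2) * f (r ^ 2)))
      (fun _ : ℝ => Real.pi⁻¹),
    ← integral_comp_rpow_Ioi_of_pos (g := fun t => Real.exp (-t) * f t) two_pos]
  -- The angular integral leaves the factor `2` that the substitution `t = r²` needs for `dt = 2 r
  -- dr`.
  have h3 : ∫ _ in Set.Ioo (-Real.pi) Real.pi, Real.pi⁻¹ = 2 := by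
    have := Real.pi_pos
    rw [setIntegral_const, measureReal_def, Real.volume_Ioo, ENNReal.toReal_ofReal (by linarith)]
    simp only [sub_neg_eq_add, smul_eq_mul]
    field_simp
    norm_num
  rw [h3, ← integral_mul_const]
  refine setIntegral_congr_fun measurableSet_Ioi fun r _ => ?_
  norm_num
  ring

theorem integral_norm_sq_stdComplexGaussian : ∫ z, ‖z‖ ^ 2 ∂stdComplexGaussian = 1 := by
  refine (integral_comp_norm_sq_stdComplexGaussian measurable_id).trans ?_
  have h := Real.Gamma_eq_integral (s := 2) two_pos
  rw [Real.Gamma_two] at h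
  rw [h]
  refine setIntegral_congr_fun measurableSet_Ioi fun r _ => ?_
  norm_num

/-- The truncation `t ↦ t 1{t ≤ τ}`. -/
noncomputable def trunc (τ t : ℝ) : ℝ := if t ≤ τ then t else 0

theorem measurable_trunc (τ : ℝ) : Measurable (trunc τ) :=
  Measurable.ite measurableSet_Iic measurable_id measurable_const

theorem trunc_nonneg {τ t : ℝ} (ht : 0 ≤ t) : 0 ≤ trunc τ t := by
  unfold trunc; split_ifs <;> simp [ht]

theorem trunc_le {τ t : ℝ} (hτ : 0 ≤ τ) : trunc τ t ≤ τ := by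
  unfold trunc; split_ifs <;> simp [*]

theorem trunc_mono {τ τ' t : ℝ} (h : τ' ≤ τ) (ht : 0 ≤ t) : trunc τ' t ≤ trunc τ t := by
  unfold trunc
  split_ifs with h1 h2
  · rfl
  · exact absurd (h1.trans h) h2
  · exact ht
  · rfl

theorem integral_trunc_mul {τ : ℝ} (hτ : 0 ≤ τ) {f : ℝ → ℝ} (hf : Measurable f) :
    ∫ z, trunc τ (‖z‖ ^ 2) * f (‖z‖ ^ 2) ∂stdComplexGaussian =
      ∫ t in (0 : ℝ)..τ, Real.exp (-t) * (t * f t) := by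
  rw [integral_comp_norm_sq_stdComplexGaussian (f := fun t => trunc τ t * f t)
    ((measurable_trunc τ).mul hf), intervalIntegral.integral_of_le hτ, ← Set.Ioi_inter_Iic,
    Set.inter_comm, ← Measure.restrict_restrict measurableSet_Iic,
    ← integral_indicator measurableSet_Iic]
  refine integral_congr_ae (.of_forall fun t => ?_)
  by_cases h : t ≤ τ <;> simp [trunc, h]

/-- The second truncated moment `E[t² 1{t ≤ τ}]` of `t = |z|²`. -/
noncomputable def secondTruncMoment (τ : ℝ) : ℝ :=
  ∫ z, trunc τ (‖z‖ ^ 2) * ‖z‖ ^ 2 ∂stdComplexGaussian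

/-- The first truncated moment `E[t 1{t ≤ τ}]` of `t = |z|²`. -/
noncomputable def firstTruncMoment (τ : ℝ) : ℝ :=
  ∫ z, trunc τ (‖z‖ ^ 2) ∂stdComplexGaussian

/-- The spectral gap. The integrand `(t² - t) exp (-t)` has antiderivative `-(t² + t + 1) exp (-t)`,
so the difference is `1 - (τ² + τ + 1) exp (-τ)`; at `τ = 3` the subtracted term is at most `13/20`.
-/
theorem secondTruncMoment_sub_firstTruncMoment {τ : ℝ} (hτ : 3 ≤ τ) :
    1 / 4 ≤ secondTruncMoment τ - firstTruncMoment τ := by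
  have h0 : 0 ≤ τ := by linarith
  have h1 := integral_trunc_mul h0 (f := fun _ => 1) measurable_const
  simp only [mul_one] at h1
  have hint : ∀ k : ℕ, IntervalIntegrable (fun t : ℝ => Real.exp (-t) * t ^ k) volume 0 τ :=
    fun k => (by fun_prop : Continuous fun t : ℝ => Real.exp (-t) * t ^ k).intervalIntegrable _ _
  have h2 : secondTruncMoment τ = _ := integral_trunc_mul h0 measurable_id
  rw [h2, firstTruncMoment, h1,
    ← intervalIntegral.integral_sub (by simpa [sq] using hint 2) (by simpa using hint 1)]
  have hd : ∀ t ∈ Set.uIcc 0 τ, HasDerivAt (fun t : ℝ => -((t ^ 2 + t + 1) * Real.exp (-t)))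
      (Real.exp (-t) * (t * id t) - Real.exp (-t) * t) t := by
    intro t _
    have h := ((((hasDerivAt_id t).pow 2).add (hasDerivAt_id t)).add_const 1).mul
      (hasDerivAt_id t).neg.exp
    refine (h.neg).congr_deriv ?_
    simp
    ring
  rw [intervalIntegral.integral_eq_sub_of_hasDerivAt hd
    ((by fun_prop : Continuous fun t : ℝ => Real.exp (-t) * (t * id t) -
      Real.exp (-t) * t).intervalIntegrable _ _)]
  have h3 : (20 : ℝ) ≤ Real.exp 3 := by
    have h := Real.exp_one_gt_d9
    have h' : Real.exp 3 = Real.exp 1 ^ 3 := by rw [← Real.exp_nat_mul]; norm_num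
    rw [h']
    calc (20 : ℝ) ≤ 2.718281 ^ 3 := by norm_num
      _ ≤ _ := by gcongr; linarith
  have h4 := Real.quadratic_le_exp_of_nonneg (sub_nonneg.2 hτ)
  have h5 : τ ^ 2 + τ + 1 ≤ 3 / 4 * Real.exp τ := by
    have h6 : Real.exp τ = Real.exp 3 * Real.exp (τ - 3) := by rw [← Real.exp_add]; ring_nf
    have h7 : 20 * (1 + (τ - 3) + (τ - 3) ^ 2 / 2) ≤ Real.exp τ := by
      rw [h6]
      have := sub_nonneg.2 hτ
      gcongr
    nlinarith
  have h6 : (τ ^ 2 + τ + 1) * Real.exp (-τ) ≤ 3 / 4 := by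
    rw [Real.exp_neg, ← div_eq_mul_inv, div_le_iff₀ (Real.exp_pos _)]
    exact h5
  simp
  linarith

/-- The integrand satisfies `t² exp (-t) ≤ 2`. This prices the passage between the levels `3 (1 -
δ)` and `3 (1 + δ)`. -/
theorem secondTruncMoment_sub_le {τ τ' : ℝ} (h' : 0 ≤ τ') (h : τ' ≤ τ) :
    secondTruncMoment τ - secondTruncMoment τ' ≤ 2 * (τ - τ') := by
  have hint : ∀ a b : ℝ, IntervalIntegrable (fun t : ℝ => Real.exp (-t) * (t * id t)) volume a b :=
    fun a b => (by fun_prop : Continuous fun t : ℝ =>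
      Real.exp (-t) * (t * id t)).intervalIntegrable _ _
  have e1 := integral_trunc_mul h' measurable_id
  have e2 := integral_trunc_mul (h'.trans h) measurable_id
  simp only [id] at e1 e2 hint
  rw [secondTruncMoment, secondTruncMoment, e1, e2,
    intervalIntegral.integral_interval_sub_left (hint _ _) (hint _ _)]
  have h1 : ∫ t in τ'..τ, Real.exp (-t) * (t * t) ≤ ∫ _ in τ'..τ, (2 : ℝ) := by
    refine intervalIntegral.integral_mono_on h (hint _ _) (by simp) fun t ht => ?_
    have h2 := Real.quadratic_le_exp_of_nonneg (h'.trans ht.1)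
    have h3 := h'.trans ht.1
    rw [Real.exp_neg, inv_mul_le_iff₀ (Real.exp_pos _)]
    nlinarith
  refine h1.trans_eq ?_
  simp
  ring

theorem integrable_norm_sq_stdComplexGaussian :
    Integrable (fun z => ‖z‖ ^ 2) stdComplexGaussian := by
  simpa using (IsGaussian.memLp_id stdComplexGaussian 2 (by simp)).integrable_norm_pow two_ne_zero

theorem secondTruncMoment_le {τ : ℝ} (hτ : 0 ≤ τ) : secondTruncMoment τ ≤ τ := by
  rw [secondTruncMoment]
  calc _ ≤ ∫ z, τ * ‖z‖ ^ 2 ∂stdComplexGaussian := by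
        refine integral_mono_of_nonneg
          (.of_forall fun z => mul_nonneg (trunc_nonneg (by positivity)) (by positivity))
          (integrable_norm_sq_stdComplexGaussian.const_mul τ) (.of_forall fun z => ?_)
        have := trunc_le (t := ‖z‖ ^ 2) hτ
        dsimp only
        gcongr
    _ = τ := by rw [integral_const_mul, integral_norm_sq_stdComplexGaussian, mul_one]

theorem firstTruncMoment_nonneg (τ : ℝ) : 0 ≤ firstTruncMoment τ :=
  integral_nonneg fun z => trunc_nonneg (by positivity)

/-! ### Dimension-free exponential moments -/

theorem exp_le_one_add_add_sq_mul_exp_abs (x : ℝ) :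
    Real.exp x ≤ 1 + x + x ^ 2 * Real.exp |x| := by
  have h := Complex.norm_exp_sub_sum_le_norm_mul_exp (x : ℂ) 2
  simp only [Finset.sum_range_succ, Finset.sum_range_zero] at h
  rw [Complex.norm_real, Real.norm_eq_abs, sq_abs] at h
  have h2 : Complex.exp x - (0 + (x : ℂ) ^ 0 / (Nat.factorial 0 : ℕ) +
      (x : ℂ) ^ 1 / (Nat.factorial 1 : ℕ)) = ((Real.exp x - (1 + x) : ℝ) : ℂ) := by
    push_cast
    simp
  rw [h2, Complex.norm_real] at h
  linarith [(le_abs_self _).trans h]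

/-- Half of the exponent `l |x|` absorbs the factor `x²`, the other half absorbs `exp |s x|`. The
error is quadratic in `s`, hence negligible against a linear gain for small `s`. -/
theorem exp_mul_le {l s x : ℝ} (hl : 0 < l) (hs : 0 ≤ s) (hsl : s ≤ l / 2) :
    Real.exp (s * x) ≤ 1 + s * x + s ^ 2 * (8 / l ^ 2) * Real.exp (l * |x|) := by
  have h1 := exp_le_one_add_add_sq_mul_exp_abs (s * x)
  have h2 := Real.quadratic_le_exp_of_nonneg (x := l / 2 * |x|) (by positivity)
  have h3 : x ^ 2 ≤ 8 / l ^ 2 * Real.exp (l / 2 * |x|) := by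
    rw [div_mul_eq_mul_div, le_div_iff₀ (by positivity)]
    have : (l / 2 * |x|) ^ 2 = l ^ 2 * x ^ 2 / 4 := by rw [mul_pow, sq_abs]; ring
    have : 0 ≤ l / 2 * |x| := by positivity
    nlinarith
  have h4 : Real.exp |s * x| ≤ Real.exp (l / 2 * |x|) := by
    rw [abs_mul, abs_of_nonneg hs]
    gcongr
  have h5 : Real.exp (l * |x|) = Real.exp (l / 2 * |x|) * Real.exp (l / 2 * |x|) := by
    rw [← Real.exp_add]; ring_nf
  have h6 : (s * x) ^ 2 * Real.exp |s * x| ≤ s ^ 2 * (8 / l ^ 2) * Real.exp (l * |x|) := by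
    rw [h5, mul_pow]
    calc s ^ 2 * x ^ 2 * Real.exp |s * x|
        ≤ s ^ 2 * (8 / l ^ 2 * Real.exp (l / 2 * |x|)) * Real.exp (l / 2 * |x|) := by gcongr
      _ = _ := by ring
  linarith

theorem integrable_comp_inner_iff {n : ℕ} {E : Type*} [NormedAddCommGroup E]
    {v : EuclideanSpace ℂ (Fin n)} (hv : ‖v‖ = 1) {f : ℂ → E}
    (hf : AEStronglyMeasurable f stdComplexGaussian) :
    Integrable (fun z => f (inner ℂ v z)) (complexGaussian n) ↔
      Integrable f stdComplexGaussian := by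
  rw [← map_inner_complexGaussian hv] at hf ⊢
  exact (integrable_map_measure hf (by fun_prop)).symm

theorem integral_comp_inner {n : ℕ} {E : Type*} [NormedAddCommGroup E] [NormedSpace ℝ E]
    {v : EuclideanSpace ℂ (Fin n)} (hv : ‖v‖ = 1) {f : ℂ → E}
    (hf : AEStronglyMeasurable f stdComplexGaussian) :
    ∫ z, f (inner ℂ v z) ∂complexGaussian n = ∫ z, f z ∂stdComplexGaussian := by
  rw [← map_inner_complexGaussian hv] at hf ⊢
  exact (integral_map (by fun_prop) hf).symm

/-- Functions of a Gaussian vector with subexponential growth in a single direction satisfy a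
one-sided exponential moment bound, uniformly in the dimension. -/
theorem exists_integral_exp_le {δ : ℝ} (hδ : 0 < δ) :
    ∃ s c : ℝ, 0 < s ∧ 0 < c ∧ ∀ (n : ℕ) (v : EuclideanSpace ℂ (Fin n))
      (f : EuclideanSpace ℂ (Fin n) → ℝ) (M : ℝ), ‖v‖ = 1 → Measurable f →
      (∀ z, |f z| ≤ 4 * ‖inner ℂ v z‖ ^ 2) → ∫ z, f z ∂complexGaussian n ≤ M →
      Integrable (fun z => Real.exp (s * f z)) (complexGaussian n) ∧
        ∫ z, Real.exp (s * f z) ∂complexGaussian n ≤ Real.exp (s * (M + δ) - c) := by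
  -- Fernique's theorem in one complex dimension; `l = C / 4` then matches the growth bound `|f| ≤ 4
  -- |v^* z|²`, and `s` makes the quadratic error at most `s δ / 2`, leaving the gain `c = s δ / 2`.
  obtain ⟨C, hC, hint⟩ := IsGaussian.exists_integrable_exp_sq stdComplexGaussian
  set K := ∫ z, Real.exp (C * ‖z‖ ^ 2) ∂stdComplexGaussian with hK
  have hK0 : 0 < K := integral_exp_pos hint
  set l := C / 4 with hl
  have hl0 : 0 < l := by positivity
  set D := 8 / l ^ 2 with hD
  have hD0 : 0 < D := by positivity
  set s := min (l / 2) (δ / (2 * (D * K))) with hs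
  have hs0 : 0 < s := by positivity
  refine ⟨s, s * δ / 2, hs0, by positivity, fun n v f M hv hf hfb hM => ?_⟩
  have hexp : Integrable (fun z => Real.exp (C * ‖inner ℂ v z‖ ^ 2)) (complexGaussian n) :=
    (integrable_comp_inner_iff hv hint.1).2 hint
  have hbd : ∀ z, Real.exp (l * |f z|) ≤ Real.exp (C * ‖inner ℂ v z‖ ^ 2) := by
    intro z
    have := hfb z
    refine Real.exp_le_exp.2 ?_
    rw [hl]
    nlinarith
  have hfi : Integrable f (complexGaussian n) := by
    refine (hexp.const_mul (1 / l)).mono' hf.aestronglyMeasurable (.of_forall fun z => ?_)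
    rw [one_div, ← div_eq_inv_mul, le_div_iff₀ hl0, Real.norm_eq_abs, mul_comm]
    exact (by linarith [Real.add_one_le_exp (l * |f z|)] : l * |f z| ≤ _).trans (hbd z)
  have hpt : ∀ z, Real.exp (s * f z) ≤
      1 + s * f z + s ^ 2 * D * Real.exp (C * ‖inner ℂ v z‖ ^ 2) := fun z =>
    (exp_mul_le hl0 hs0.le (min_le_left _ _)).trans (by
      have := mul_le_mul_of_nonneg_left (hbd z) (by positivity : 0 ≤ s ^ 2 * D)
      linarith)
  have hli : Integrable (fun z => 1 + s * f z) (complexGaussian n) :=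
    (integrable_const _).add (hfi.const_mul s)
  have hri : Integrable (fun z => 1 + s * f z + s ^ 2 * D *
      Real.exp (C * ‖inner ℂ v z‖ ^ 2)) (complexGaussian n) :=
    hli.add (hexp.const_mul _)
  have hi : Integrable (fun z => Real.exp (s * f z)) (complexGaussian n) :=
    hri.mono' (by fun_prop) (.of_forall fun z => by
      rw [Real.norm_eq_abs, Real.abs_exp]; exact hpt z)
  refine ⟨hi, (integral_mono hi hri hpt).trans ?_⟩
  rw [integral_add hli (hexp.const_mul _),
    integral_add (integrable_const _) (hfi.const_mul s), integral_const_mul, integral_const_mul,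
    integral_comp_inner hv hint.1, ← hK]
  have h1 : s * (D * K) ≤ δ / 2 := by
    calc s * (D * K) ≤ δ / (2 * (D * K)) * (D * K) := by
          gcongr
          exact min_le_right _ _
      _ = δ / 2 := by field_simp
  have h2 : s * ∫ z, f z ∂complexGaussian n ≤ s * M := by gcongr
  have h3 : s ^ 2 * D * K ≤ s * (δ / 2) := by
    calc s ^ 2 * D * K = s * (s * (D * K)) := by ring
      _ ≤ _ := by gcongr
  have h4 := Real.add_one_le_exp (s * (M + δ) - s * δ / 2)
  simp
  nlinarith

/-! ### Expectation of the truncated form -/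

theorem integral_re_ofReal_gaussianReal :
    ∫ x, (x : ℂ) ∂gaussianReal 0 (1 / 2 : ℝ≥0) = 0 := by
  rw [integral_complex_ofReal, integral_id_gaussianReal, Complex.ofReal_zero]

theorem integral_id_stdComplexGaussian : ∫ z, z ∂stdComplexGaussian = 0 := by
  have hi : Integrable (fun x : ℝ => (x : ℂ)) (gaussianReal 0 (1 / 2 : ℝ≥0)) :=
    ((IsGaussian.memLp_id (gaussianReal 0 (1 / 2 : ℝ≥0)) 1 (by simp)).integrable le_rfl).ofReal
  rw [stdComplexGaussian, integral_map measurable_ofReal_add_ofReal_mul_I.aemeasurable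
    (by fun_prop), integral_add (hi.comp_fst _) ((hi.comp_snd _).mul_const _), integral_mul_const,
    integral_fun_fst (fun x : ℝ => (x : ℂ)), integral_fun_snd (fun x : ℝ => (x : ℂ)),
    integral_re_ofReal_gaussianReal]
  simp

/-- The expectation of the truncated quadratic form `1{|u^* a|² ≤ τ} |u^* a|² |v^* a|²`. -/
theorem integral_trunc_mul_norm_inner_sq {n : ℕ} {u v : EuclideanSpace ℂ (Fin n)}
    (hu : ‖u‖ = 1) (hv : ‖v‖ = 1) {τ : ℝ} (hτ : 0 ≤ τ) :
    ∫ a, trunc τ (‖inner ℂ u a‖ ^ 2) * ‖inner ℂ v a‖ ^ 2 ∂complexGaussian n =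
      secondTruncMoment τ * ‖inner ℂ u v‖ ^ 2 +
        firstTruncMoment τ * (1 - ‖inner ℂ u v‖ ^ 2) := by
  have hbm : Measurable fun z : ℂ => trunc τ (‖z‖ ^ 2) := (measurable_trunc τ).comp (by fun_prop)
  have hsq := integrable_norm_sq_stdComplexGaussian
  have hbi : ∀ {f : ℂ → ℂ}, Integrable f stdComplexGaussian →
      Integrable (fun z => (trunc τ (‖z‖ ^ 2) : ℂ) * f z) stdComplexGaussian := fun hf =>
    hf.bdd_mul (c := τ) (Complex.measurable_ofReal.comp hbm).aestronglyMeasurable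
      (.of_forall fun z => by
      rw [Complex.norm_real, Real.norm_of_nonneg (trunc_nonneg (by positivity))]
      exact trunc_le hτ)
  have hbi' : ∀ {f : ℂ → ℝ}, Integrable f stdComplexGaussian →
      Integrable (fun z => trunc τ (‖z‖ ^ 2) * f z) stdComplexGaussian := fun hf =>
    hf.bdd_mul (c := τ) hbm.aestronglyMeasurable (.of_forall fun z => by
      rw [Real.norm_of_nonneg (trunc_nonneg (by positivity))]
      exact trunc_le hτ)
  -- Split `v` into its component along `u` and an orthogonal remainder, whose Gaussian coefficients
  -- are independent. The remainder may vanish, so it is normalized only after that case is removed.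
  set α := inner ℂ u v with hα
  set w' := v - α • u with hw'
  have huu : inner ℂ u u = 1 := by rw [inner_self_eq_norm_sq_to_K, hu]; simp
  have huw' : inner ℂ u w' = 0 := by
    rw [hw', inner_sub_right, inner_smul_right, huu, ← hα]; ring
  have hvw : v = α • u + w' := by rw [hw']; abel
  have hnorm : ‖α‖ ^ 2 + ‖w'‖ ^ 2 = 1 := by
    have h := norm_add_sq_eq_norm_sq_add_norm_sq_of_inner_eq_zero (𝕜 := ℂ) (α • u) w'
      (by rw [inner_smul_left, huw', mul_zero])
    rw [← hvw, hv, norm_smul, hu] at h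
    linarith
  rcases eq_or_ne w' 0 with h0 | h0
  · have h1 : ‖α‖ ^ 2 = 1 := by simpa [h0] using hnorm
    have h2 : ∀ a, ‖inner ℂ v a‖ ^ 2 = ‖inner ℂ u a‖ ^ 2 := by
      intro a
      rw [hvw, h0, add_zero, inner_smul_left, norm_mul, mul_pow, RCLike.norm_conj, h1, one_mul]
    simp_rw [h2]
    rw [integral_comp_inner hu (f := fun z => trunc τ (‖z‖ ^ 2) * ‖z‖ ^ 2) (by fun_prop), h1,
      secondTruncMoment]
    ring
  set β := ‖w'‖ with hβ
  have hβ0 : β ≠ 0 := norm_ne_zero_iff.2 h0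
  set w := ((β : ℂ)⁻¹) • w' with hw
  have hwn : ‖w‖ = 1 := by
    rw [hw, norm_smul, norm_inv, Complex.norm_real, Real.norm_of_nonneg (norm_nonneg _)]
    exact inv_mul_cancel₀ hβ0
  have huw : inner ℂ u w = 0 := by rw [hw, inner_smul_right, huw', mul_zero]
  have hvw2 : v = α • u + (β : ℂ) • w := by
    rw [hw, smul_smul, mul_inv_cancel₀ (by exact_mod_cast hβ0), one_smul]
    exact hvw
  have key : ∀ a : EuclideanSpace ℂ (Fin n), ‖inner ℂ v a‖ ^ 2 =
      ‖α‖ ^ 2 * ‖inner ℂ u a‖ ^ 2 + β ^ 2 * ‖inner ℂ w a‖ ^ 2 +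
        2 * β * ((starRingEnd ℂ α * inner ℂ u a) * starRingEnd ℂ (inner ℂ w a)).re := by
    intro a
    rw [hvw2, inner_add_left, inner_smul_left, inner_smul_left]
    simp only [Complex.sq_norm, Complex.normSq_apply, Complex.add_re, Complex.add_im,
      Complex.mul_re, Complex.mul_im, Complex.conj_re, Complex.conj_im, Complex.ofReal_re,
      Complex.ofReal_im]
    ring
  have hm := map_inner_prodMk_inner_complexGaussian hu hwn huw
  have hpm : Measurable fun a : EuclideanSpace ℂ (Fin n) => (inner ℂ u a, inner ℂ w a) := by
    fun_prop
  have hconj : Integrable (fun z : ℂ => starRingEnd ℂ z) stdComplexGaussian := by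
    have h := (IsGaussian.memLp_id stdComplexGaussian 1 (by simp)).integrable le_rfl
    exact (integrable_norm_iff (by fun_prop)).1 (by simpa using h.norm)
  have hlin : Integrable (fun z : ℂ => (trunc τ (‖z‖ ^ 2) : ℂ) * (starRingEnd ℂ α * z))
      stdComplexGaussian :=
    hbi (((IsGaussian.memLp_id stdComplexGaussian 1 (by simp)).integrable le_rfl).const_mul _)
  have i1 : Integrable (fun p : ℂ × ℂ => ‖α‖ ^ 2 * (trunc τ (‖p.1‖ ^ 2) * ‖p.1‖ ^ 2))
      (stdComplexGaussian.prod stdComplexGaussian) :=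
    ((hbi' hsq).comp_fst _).const_mul _
  have hb1 : Integrable (fun z : ℂ => trunc τ (‖z‖ ^ 2)) stdComplexGaussian := by
    simpa using hbi' (integrable_const (1 : ℝ))
  have i2 : Integrable (fun p : ℂ × ℂ => β ^ 2 * (trunc τ (‖p.1‖ ^ 2) * ‖p.2‖ ^ 2))
      (stdComplexGaussian.prod stdComplexGaussian) := (hb1.mul_prod hsq).const_mul _
  have i12 : Integrable (fun p : ℂ × ℂ => ‖α‖ ^ 2 * (trunc τ (‖p.1‖ ^ 2) * ‖p.1‖ ^ 2) +
      β ^ 2 * (trunc τ (‖p.1‖ ^ 2) * ‖p.2‖ ^ 2)) (stdComplexGaussian.prod stdComplexGaussian) :=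
    i1.add i2
  have i3 : Integrable (fun p : ℂ × ℂ => (trunc τ (‖p.1‖ ^ 2) : ℂ) * (starRingEnd ℂ α * p.1) *
      starRingEnd ℂ p.2) (stdComplexGaussian.prod stdComplexGaussian) := hlin.mul_prod hconj
  have i3' : Integrable (fun p : ℂ × ℂ => 2 * β * ((trunc τ (‖p.1‖ ^ 2) : ℂ) *
      (starRingEnd ℂ α * p.1) * starRingEnd ℂ p.2).re)
      (stdComplexGaussian.prod stdComplexGaussian) := i3.re.const_mul _
  -- The cross term factors by independence, and one factor is the mean of a centred Gaussian.
  have e3 : ∫ p : ℂ × ℂ, ((trunc τ (‖p.1‖ ^ 2) : ℂ) *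
      (starRingEnd ℂ α * p.1) * starRingEnd ℂ p.2).re
      ∂(stdComplexGaussian.prod stdComplexGaussian) = 0 := by
    have h := integral_re i3
    rw [integral_prod_mul (fun z : ℂ => (trunc τ (‖z‖ ^ 2) : ℂ) * (starRingEnd ℂ α * z))
      (fun z : ℂ => starRingEnd ℂ z), integral_conj, integral_id_stdComplexGaussian] at h
    simpa using h
  calc _ = ∫ a, (fun p : ℂ × ℂ => ‖α‖ ^ 2 * (trunc τ (‖p.1‖ ^ 2) * ‖p.1‖ ^ 2) +
        β ^ 2 * (trunc τ (‖p.1‖ ^ 2) * ‖p.2‖ ^ 2) +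
        2 * β * ((trunc τ (‖p.1‖ ^ 2) : ℂ) * (starRingEnd ℂ α * p.1) * starRingEnd ℂ p.2).re)
        (inner ℂ u a, inner ℂ w a) ∂complexGaussian n := by
        refine integral_congr_ae (.of_forall fun a => ?_)
        simp only
        rw [key a, mul_assoc (Complex.ofReal _), Complex.re_ofReal_mul]
        ring
    _ = ∫ p : ℂ × ℂ, (‖α‖ ^ 2 * (trunc τ (‖p.1‖ ^ 2) * ‖p.1‖ ^ 2) +
        β ^ 2 * (trunc τ (‖p.1‖ ^ 2) * ‖p.2‖ ^ 2) +
        2 * β * ((trunc τ (‖p.1‖ ^ 2) : ℂ) * (starRingEnd ℂ α * p.1) * starRingEnd ℂ p.2).re)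
        ∂(stdComplexGaussian.prod stdComplexGaussian) := by
        have := (i12.add i3').1
        rw [← hm] at this ⊢
        exact (integral_map hpm.aemeasurable this).symm
    _ = _ := by
        rw [integral_add i12 i3', integral_add i1 i2, integral_const_mul,
          integral_const_mul, integral_const_mul, e3,
          integral_fun_fst (fun z : ℂ => trunc τ (‖z‖ ^ 2) * ‖z‖ ^ 2),
          integral_prod_mul (fun z : ℂ => trunc τ (‖z‖ ^ 2)) (fun z : ℂ => ‖z‖ ^ 2),
          integral_norm_sq_stdComplexGaussian, secondTruncMoment, firstTruncMoment,
          ← eq_sub_iff_add_eq'.2 hnorm]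
        simp
        ring

/-! ### Chernoff bound -/

/-- Chernoff bound for sums `∑ f(a_k)` over a Gaussian model, where `f` has subexponential growth in
a single direction. The rate does not depend on the dimension. -/
theorem exists_measureReal_le_exp {δ : ℝ} (hδ : 0 < δ) :
    ∃ c : ℝ, 0 < c ∧ ∀ {m n : ℕ} {Ω : Type*} [MeasurableSpace Ω] (μ : Measure Ω)
      [IsProbabilityMeasure μ] (a : Fin m → Ω → EuclideanSpace ℂ (Fin n)),
      IsGaussianModel a μ → ∀ (v : EuclideanSpace ℂ (Fin n))
      (f : EuclideanSpace ℂ (Fin n) → ℝ) (M : ℝ), ‖v‖ = 1 → Measurable f →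
      (∀ z, |f z| ≤ 4 * ‖inner ℂ v z‖ ^ 2) → ∫ z, f z ∂complexGaussian n ≤ M →
      μ.real {ω | (m : ℝ) * (M + δ) ≤ ∑ k, f (a k ω)} ≤ Real.exp (-c * m) := by
  obtain ⟨s, c, hs, hc, H⟩ := exists_integral_exp_le hδ
  refine ⟨c, hc, fun {m n Ω} _ μ _ a ha v f M hv hf hfb hM => ?_⟩
  obtain ⟨hi, hle⟩ := H n v f M hv hf hfb hM
  have ham : ∀ k, AEMeasurable (a k) μ := fun k => (ha.hasLaw k).aemeasurable
  have hind : iIndepFun (fun k ω => f (a k ω)) μ := ha.indep.comp (fun _ => f) fun _ => hf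
  have hXm : ∀ k, AEMeasurable (fun ω => f (a k ω)) μ := fun k => hf.comp_aemeasurable (ham k)
  have hfs : Measurable fun z => Real.exp (s * f z) := by fun_prop
  have hXi : ∀ k, Integrable (fun ω => Real.exp (s * f (a k ω))) μ := fun k => by
    rw [← (ha.hasLaw k).map_eq] at hi
    exact hi.comp_aemeasurable (ham k)
  have hmgf : ∀ k, mgf (fun ω => f (a k ω)) μ s ≤ Real.exp (s * (M + δ) - c) := fun k => by
    refine le_trans (le_of_eq ?_) hle
    rw [← (ha.hasLaw k).map_eq, integral_map (ham k) hfs.aestronglyMeasurable]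
    rfl
  -- A non-integrable function has Bochner integral zero, whereas this one equals a product of
  -- positive moment generating functions.
  have hsum : Integrable (fun ω => Real.exp (s * (∑ k, fun ω => f (a k ω)) ω)) μ :=
    .of_integral_ne_zero <| ne_of_gt <| by
      change 0 < mgf (∑ k, fun ω => f (a k ω)) μ s
      rw [hind.mgf_sum₀ hXm]
      exact Finset.prod_pos fun k _ => mgf_pos (hXi k)
  have h := measure_ge_le_exp_mul_mgf (X := ∑ k, fun ω => f (a k ω)) ((m : ℝ) * (M + δ)) hs.le hsum
  rw [hind.mgf_sum₀ hXm] at h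
  simp only [Finset.sum_apply] at h
  refine h.trans ?_
  calc _ ≤ Real.exp (-s * (m * (M + δ))) * ∏ _k : Fin m, Real.exp (s * (M + δ) - c) := by
        gcongr with k
        · exact fun _ _ => mgf_nonneg
        · exact hmgf k
    _ = Real.exp (-c * m) := by
        rw [Finset.prod_const, Finset.card_univ, Fintype.card_fin, ← Real.exp_nat_mul,
          ← Real.exp_add]
        ring_nf

/-! ### Nets of the unit sphere -/

open Module Metric Set in
open scoped Function ENNReal in
/-- The cardinality of an `ε`-separated subset of the unit ball. -/
theorem card_le_of_separated_of_norm_le_one {E : Type*} [NormedAddCommGroup E] [NormedSpace ℝ E]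
    [FiniteDimensional ℝ E] {ε : ℝ} (hε : 0 < ε) (s : Finset E) (hs : ∀ c ∈ s, ‖c‖ ≤ 1)
    (h : ∀ c ∈ s, ∀ d ∈ s, c ≠ d → ε ≤ ‖c - d‖) : (s.card : ℝ) ≤ (1 + 2 / ε) ^ finrank ℝ E := by
  borelize E
  let μ : Measure E := Measure.addHaar
  have hε2 : 0 < ε / 2 := by positivity
  have hρ : 0 < 1 + ε / 2 := by positivity
  -- Volume comparison: disjoint balls of radius `ε / 2` all lie in the ball of radius `1 + ε / 2`.
  have D : Set.Pairwise (s : Set E) (Disjoint on fun c => ball (c : E) (ε / 2)) := by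
    intro c hc d hd hcd
    apply ball_disjoint_ball
    rw [dist_eq_norm, add_halves]
    exact h c hc d hd hcd
  have hsub : (⋃ c ∈ s, ball (c : E) (ε / 2)) ⊆ ball (0 : E) (1 + ε / 2) := by
    refine iUnion₂_subset fun x hx => ball_subset_ball' ?_
    rw [dist_zero_right, add_comm]
    gcongr
    exact hs x hx
  have I : (s.card : ℝ≥0∞) * ENNReal.ofReal ((ε / 2) ^ finrank ℝ E) * μ (ball 0 1) ≤
      ENNReal.ofReal ((1 + ε / 2) ^ finrank ℝ E) * μ (ball 0 1) :=
    calc _ = μ (⋃ c ∈ s, ball (c : E) (ε / 2)) := by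
          rw [measure_biUnion_finset D fun c _ => measurableSet_ball]
          simp only [μ.addHaar_ball_of_pos _ hε2, Finset.sum_const, nsmul_eq_mul, mul_assoc]
      _ ≤ μ (ball (0 : E) (1 + ε / 2)) := measure_mono hsub
      _ = _ := μ.addHaar_ball_of_pos _ hρ
  have J := (ENNReal.mul_le_mul_iff_left (measure_ball_pos _ _ zero_lt_one).ne'
    measure_ball_lt_top.ne).1 I
  have K := ENNReal.toReal_le_of_le_ofReal (by positivity) J
  rw [ENNReal.toReal_mul, ENNReal.toReal_natCast, ENNReal.toReal_ofReal (by positivity),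
    ← le_div_iff₀ (by positivity), ← div_pow] at K
  refine K.trans_eq ?_
  congr 1
  field_simp
  ring

open Module in
/-- Existence of small `ε`-nets of the unit sphere. -/
theorem exists_finset_net_sphere {E : Type*} [NormedAddCommGroup E] [NormedSpace ℝ E]
    [FiniteDimensional ℝ E] {ε : ℝ} (hε : 0 < ε) :
    ∃ N : Finset E, (∀ v ∈ N, ‖v‖ = 1) ∧ (∀ v, ‖v‖ = 1 → ∃ w ∈ N, ‖v - w‖ ≤ ε) ∧
      (N.card : ℝ) ≤ (1 + 2 / ε) ^ finrank ℝ E := by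
  classical
  let P : ℕ → Prop := fun k => ∃ s : Finset E, (∀ v ∈ s, ‖v‖ = 1) ∧
    (∀ c ∈ s, ∀ d ∈ s, c ≠ d → ε ≤ ‖c - d‖) ∧ s.card = k
  have hP : ∀ k, P k → k ≤ ⌊(1 + 2 / ε) ^ finrank ℝ E⌋₊ := by
    rintro k ⟨s, h1, h2, rfl⟩
    exact Nat.le_floor (card_le_of_separated_of_norm_le_one hε s (fun c hc => (h1 c hc).le) h2)
  have h0 : P 0 := ⟨∅, by simp, by simp, rfl⟩
  -- A separated set of largest cardinality is a net, since any uncovered unit vector could be added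
  -- to it.
  obtain ⟨s, h1, h2, h3⟩ := Nat.findGreatest_spec (P := P) (Nat.zero_le _) h0
  refine ⟨s, h1, fun v hv => ?_,
    card_le_of_separated_of_norm_le_one hε s (fun c hc => (h1 c hc).le) h2⟩
  by_contra! hcon
  have hvs : v ∉ s := fun hmem => by
    have := hcon v hmem
    rw [sub_self, norm_zero] at this
    exact this.not_gt hε
  have hP1 : P (s.card + 1) := by
    refine ⟨insert v s, ?_, ?_, Finset.card_insert_of_notMem hvs⟩
    · intro w hw
      rcases Finset.mem_insert.1 hw with rfl | hw
      exacts [hv, h1 w hw]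
    · intro c hc d hd hcd
      rw [Finset.mem_insert] at hc hd
      rcases hc with rfl | hc <;> rcases hd with rfl | hd
      · exact absurd rfl hcd
      · exact (hcon d hd).le
      · rw [norm_sub_rev]; exact (hcon c hc).le
      · exact h2 c hc d hd hcd
  have := Nat.le_findGreatest (hP _ hP1) hP1
  rw [← h3] at this
  exact absurd this (by simp)

/-- Control of a linear map on an `ε`-net of the unit sphere extends to the sphere. -/
theorem norm_sq_le_of_net {E F : Type*} [NormedAddCommGroup E] [NormedSpace ℂ E]
    [NormedAddCommGroup F] [NormedSpace ℂ F] (T : E →L[ℂ] F) {N : Set E} {ε : ℝ} (hε : 0 ≤ ε)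
    (hε' : ε ≤ 1 / 2) (hN : ∀ v, ‖v‖ = 1 → ∃ w ∈ N, ‖v - w‖ ≤ ε) (hT : ∀ w ∈ N, ‖T w‖ ≤ 3)
    {v : E} (hv : ‖v‖ = 1) : ∃ w ∈ N, ‖v - w‖ ≤ ε ∧ ‖T v‖ ^ 2 ≤ ‖T w‖ ^ 2 + 54 * ε := by
  have hstep : ∀ v w : E, ‖v - w‖ ≤ ε → ‖T v‖ ≤ ‖T w‖ + ‖T‖ * ε := fun v w h => by
    calc ‖T v‖ = ‖T w + T (v - w)‖ := by rw [← map_add]; congr 2; abel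
      _ ≤ ‖T w‖ + ‖T (v - w)‖ := norm_add_le _ _
      _ ≤ ‖T w‖ + ‖T‖ * ε := by gcongr; exact T.le_of_opNorm_le_of_le le_rfl h
  have h6 : ‖T‖ ≤ 6 := by
    have h : ‖T‖ ≤ 3 + ‖T‖ * ε := by
      refine T.opNorm_le_of_unit_norm (by positivity) fun v hv => ?_
      obtain ⟨w, hw, hvw⟩ := hN v hv
      linarith [hstep v w hvw, hT w hw]
    -- Since `ε ≤ 1 / 2`, the term `‖T‖ * ε` is absorbed on the left.
    nlinarith [norm_nonneg T]
  obtain ⟨w, hw, hvw⟩ := hN v hv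
  refine ⟨w, hw, hvw, ?_⟩
  have h1 : ‖T v‖ ≤ ‖T w‖ + 6 * ε := (hstep v w hvw).trans (by gcongr)
  have h2 := hT w hw
  calc ‖T v‖ ^ 2 ≤ (‖T w‖ + 6 * ε) ^ 2 := by gcongr
    _ ≤ _ := by nlinarith [norm_nonneg (T w)]

/-! ### Quadratic forms, leading eigenvectors and rank-one matrices -/

theorem sampling_outer {m n : ℕ} (a : Fin m → EuclideanSpace ℂ (Fin n))
    (x : EuclideanSpace ℂ (Fin n)) (k : Fin m) :
    sampling a (outer x) k = ‖inner ℂ x (a k)‖ ^ 2 := by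
  rw [sampling, outer, outer, Matrix.vecMulVec_mul_vecMulVec, Matrix.trace_vecMulVec,
    Complex.sq_norm, ← Complex.ofReal_re (Complex.normSq _), Complex.normSq_eq_conj_mul_self,
    inner_conj_symm, EuclideanSpace.inner_eq_star_dotProduct,
    EuclideanSpace.inner_eq_star_dotProduct, dotProduct_smul, smul_eq_mul,
    dotProduct_comm x.ofLp]

theorem inner_outer_apply {n : ℕ} (z v : EuclideanSpace ℂ (Fin n)) :
    inner ℂ v (Matrix.toEuclideanLin (outer z) v) = ((‖inner ℂ v z‖ ^ 2 : ℝ) : ℂ) := by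
  have h : Matrix.toEuclideanLin (outer z) v = inner ℂ z v • z := by
    ext i
    simp [Matrix.toLpLin_apply, outer, Matrix.vecMulVec_mulVec,
      EuclideanSpace.inner_eq_star_dotProduct, dotProduct_comm]
  rw [h, inner_smul_right, ← inner_conj_symm, ← Complex.normSq_eq_conj_mul_self, Complex.sq_norm]

theorem inner_truncatedMatrix_apply {m n : ℕ} (a : Fin m → EuclideanSpace ℂ (Fin n))
    (y : Fin m → ℝ) (v : EuclideanSpace ℂ (Fin n)) :
    inner ℂ v (Matrix.toEuclideanLin (truncatedMatrix a y) v) =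
      ((1 / m * ∑ k, trunc (3 / m * l1Norm y) (y k) * ‖inner ℂ v (a k)‖ ^ 2 : ℝ) : ℂ) := by
  have h : ∀ k, (if y k ≤ 3 / (m : ℝ) * l1Norm y then (y k : ℂ) • outer (a k) else 0) =
      (trunc (3 / m * l1Norm y) (y k) : ℂ) • outer (a k) := by
    intro k
    unfold trunc
    split_ifs <;> simp
  simp only [truncatedMatrix, h, map_smul, map_sum, LinearMap.smul_apply, LinearMap.sum_apply,
    inner_smul_right, inner_sum, inner_outer_apply]
  push_cast
  rfl

/-- Rayleigh's principle: in an orthonormal eigenbasis the form is an average of eigenvalues with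
weights `|e_i^* v|²`, hence at most the largest one, which `z` attains. -/
theorem IsLeadingEigenvector.re_inner_le {n : ℕ} {M : Matrix (Fin n) (Fin n) ℂ}
    {z : EuclideanSpace ℂ (Fin n)} (hM : M.IsHermitian) (hz : IsLeadingEigenvector M z)
    {v : EuclideanSpace ℂ (Fin n)} (hv : ‖v‖ = 1) :
    (inner ℂ v (Matrix.toEuclideanLin M v)).re ≤ (inner ℂ z (Matrix.toEuclideanLin M z)).re := by
  obtain ⟨hz1, l, hl, hmax⟩ := hz
  have hT : (Matrix.toEuclideanLin M).IsSymmetric := Matrix.isSymmetric_toEuclideanLin_iff.2 hM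
  have hn : Module.finrank ℂ (EuclideanSpace ℂ (Fin n)) = n := by simp
  have hzl : (inner ℂ z (Matrix.toEuclideanLin M z)).re = l := by
    rw [hl.apply_eq_smul, inner_smul_right, inner_self_eq_norm_sq_to_K, hz1]
    simp
  rw [hzl, ← (hT.eigenvectorBasis hn).sum_inner_mul_inner, Complex.re_sum]
  have hterm : ∀ i, (inner ℂ v (hT.eigenvectorBasis hn i) *
      inner ℂ (hT.eigenvectorBasis hn i) (Matrix.toEuclideanLin M v)).re =
        hT.eigenvalues hn i * ‖inner ℂ (hT.eigenvectorBasis hn i) v‖ ^ 2 := by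
    intro i
    rw [← hT, hT.apply_eigenvectorBasis, inner_smul_left, Complex.sq_norm,
      ← Complex.ofReal_re (Complex.normSq _), Complex.normSq_eq_conj_mul_self, inner_conj_symm,
      mul_left_comm]
    simp [-inner_conj_symm]
  simp_rw [hterm]
  calc _ ≤ ∑ i, l * ‖inner ℂ (hT.eigenvectorBasis hn i) v‖ ^ 2 := by
        gcongr with i
        exact hmax _ (hT.hasEigenvalue_eigenvalues hn i)
    _ = l := by
        rw [← Finset.mul_sum, (hT.eigenvectorBasis hn).sum_sq_norm_inner_right, hv]
        simp

/-- The Frobenius inner product of `z z^*` and `u u^*` is `|u^* z|²`. This turns alignment up to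
phase into a matrix distance. -/
theorem norm_outer_sub_outer_sq {n : ℕ} (z u : EuclideanSpace ℂ (Fin n)) :
    ‖outer z - outer u‖ ^ 2 = ‖z‖ ^ 4 + ‖u‖ ^ 4 - 2 * ‖inner ℂ u z‖ ^ 2 := by
  have h : ‖outer z - outer u‖ ^ 2 = ∑ i, ∑ j, ‖z i * star (z j) - u i * star (u j)‖ ^ 2 := by
    rw [Matrix.frobenius_norm_def, ← Real.rpow_natCast, ← Real.rpow_mul (by positivity)]
    norm_num [outer, Matrix.vecMulVec_apply]
  have h2 : ∀ i j, ‖z i * star (z j) - u i * star (u j)‖ ^ 2 =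
      ‖z i‖ ^ 2 * ‖z j‖ ^ 2 + ‖u i‖ ^ 2 * ‖u j‖ ^ 2 -
        2 * ((star (u i) * z i) * star (star (u j) * z j)).re := by
    intro i j
    simp only [Complex.sq_norm, Complex.normSq_apply, Complex.sub_re, Complex.sub_im,
      Complex.mul_re, Complex.mul_im, Complex.star_def, Complex.conj_re, Complex.conj_im]
    ring
  have h3 : inner ℂ u z = ∑ i, star (u i) * z i := by
    rw [PiLp.inner_apply]
    exact Finset.sum_congr rfl fun i _ => by simp [mul_comm]
  have h4 : ‖inner ℂ u z‖ ^ 2 = (inner ℂ u z * star (inner ℂ u z)).re := by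
    rw [Complex.star_def, Complex.mul_conj, Complex.sq_norm, Complex.ofReal_re]
  have h5 : ∀ w : EuclideanSpace ℂ (Fin n), ‖w‖ ^ 4 = (∑ i, ‖w i‖ ^ 2) * ∑ j, ‖w j‖ ^ 2 := by
    intro w
    rw [← EuclideanSpace.norm_sq_eq]
    ring
  rw [h, h4, h3, h5, h5, star_sum, Finset.sum_mul_sum, Finset.sum_mul_sum, Finset.sum_mul_sum,
    Complex.re_sum]
  simp_rw [h2, Complex.re_sum, Finset.sum_sub_distrib, Finset.sum_add_distrib, Finset.mul_sum]

theorem outer_zero {n : ℕ} : outer (0 : EuclideanSpace ℂ (Fin n)) = 0 := by simp [outer]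

theorem norm_outer {n : ℕ} (x : EuclideanSpace ℂ (Fin n)) : ‖outer x‖ = ‖x‖ ^ 2 := by
  have h := norm_outer_sub_outer_sq x 0
  rw [outer_zero, sub_zero] at h
  rw [← sq_eq_sq₀ (norm_nonneg _) (by positivity), h]
  simp
  ring

theorem outer_real_smul {n : ℕ} (r : ℝ) (x : EuclideanSpace ℂ (Fin n)) :
    outer ((r : ℂ) • x) = ((r ^ 2 : ℝ) : ℂ) • outer x := by
  ext i j
  simp [outer, Matrix.vecMulVec_apply]
  ring

/-- The linear map `v ↦ (√(b_k) ⟨a_k, v⟩)_k`. -/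
noncomputable def weightedAnalysis {m n : ℕ} (a : Fin m → EuclideanSpace ℂ (Fin n))
    (b : Fin m → ℝ) : EuclideanSpace ℂ (Fin n) →L[ℂ] EuclideanSpace ℂ (Fin m) :=
  LinearMap.toContinuousLinearMap ((WithLp.linearEquiv 2 ℂ (Fin m → ℂ)).symm.toLinearMap ∘ₗ
    LinearMap.pi fun k => ((√(b k) : ℝ) : ℂ) • (innerSL ℂ (a k)).toLinearMap)

/-- Presents the truncated form as the squared norm of a linear map, so that the net argument
applies. -/
theorem norm_weightedAnalysis_sq {m n : ℕ} (a : Fin m → EuclideanSpace ℂ (Fin n))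
    {b : Fin m → ℝ} (hb : ∀ k, 0 ≤ b k) (v : EuclideanSpace ℂ (Fin n)) :
    ‖weightedAnalysis a b v‖ ^ 2 = ∑ k, b k * ‖inner ℂ v (a k)‖ ^ 2 := by
  rw [EuclideanSpace.norm_sq_eq]
  refine Finset.sum_congr rfl fun k _ => ?_
  have h : weightedAnalysis a b v k = ((√(b k) : ℝ) : ℂ) * inner ℂ (a k) v := rfl
  rw [h, norm_mul, mul_pow, Complex.norm_real, Real.norm_eq_abs, sq_abs, Real.sq_sqrt (hb k),
    norm_inner_symm]

theorem norm_inner_sq_sub_le {n : ℕ} {u v w : EuclideanSpace ℂ (Fin n)} (hu : ‖u‖ = 1)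
    (hv : ‖v‖ = 1) (hw : ‖w‖ = 1) : ‖inner ℂ u w‖ ^ 2 - ‖inner ℂ u v‖ ^ 2 ≤ 2 * ‖v - w‖ := by
  have h1 : ‖inner ℂ u w‖ ≤ 1 := by simpa [hu, hw] using norm_inner_le_norm (𝕜 := ℂ) u w
  have h2 : ‖inner ℂ u v‖ ≤ 1 := by simpa [hu, hv] using norm_inner_le_norm (𝕜 := ℂ) u v
  have h3 : ‖inner ℂ u w‖ - ‖inner ℂ u v‖ ≤ ‖v - w‖ := by
    calc _ ≤ ‖inner ℂ u w - inner ℂ u v‖ := norm_sub_norm_le _ _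
      _ ≤ ‖u‖ * ‖w - v‖ := by rw [← inner_sub_right]; exact norm_inner_le_norm _ _
      _ = ‖v - w‖ := by rw [hu, one_mul, norm_sub_rev]
  nlinarith [norm_nonneg (inner ℂ u w), norm_nonneg (inner ℂ u v), norm_nonneg (v - w)]

/-! ### Deterministic estimates on the good event -/

/-- The truncated quadratic form concentrates well enough: a one-sided bound on a net of the sphere
and a lower bound at `u` force the maximizers of the form to be close to `u`, up to phase. -/
theorem one_sub_norm_inner_sq_le {m n : ℕ} (hm : 0 < m) {δ τ : ℝ} (hδ : 0 < δ) (hδ' : δ ≤ 1 / 6)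
    (hτ : τ ∈ Set.Icc (3 * (1 - δ)) (3 * (1 + δ)))
    {a : Fin m → EuclideanSpace ℂ (Fin n)} {u z : EuclideanSpace ℂ (Fin n)} (hu : ‖u‖ = 1)
    (hz : ‖z‖ = 1) {N : Set (EuclideanSpace ℂ (Fin n))} (hN1 : ∀ w ∈ N, ‖w‖ = 1)
    (hN : ∀ v, ‖v‖ = 1 → ∃ w ∈ N, ‖v - w‖ ≤ δ)
    (hlow : m * (secondTruncMoment (3 * (1 - δ)) - δ) ≤
      ∑ k, trunc (3 * (1 - δ)) (‖inner ℂ u (a k)‖ ^ 2) * ‖inner ℂ u (a k)‖ ^ 2)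
    (hup : ∀ w ∈ N, ∑ k, trunc (3 * (1 + δ)) (‖inner ℂ u (a k)‖ ^ 2) * ‖inner ℂ w (a k)‖ ^ 2 ≤
      m * (secondTruncMoment (3 * (1 + δ)) * ‖inner ℂ u w‖ ^ 2 +
        firstTruncMoment (3 * (1 + δ)) * (1 - ‖inner ℂ u w‖ ^ 2) + δ))
    (hmax : ∑ k, trunc τ (‖inner ℂ u (a k)‖ ^ 2) * ‖inner ℂ u (a k)‖ ^ 2 ≤
      ∑ k, trunc τ (‖inner ℂ u (a k)‖ ^ 2) * ‖inner ℂ z (a k)‖ ^ 2) :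
    1 - ‖inner ℂ u z‖ ^ 2 ≤ 304 * δ := by
  have hm' : (0 : ℝ) < m := by exact_mod_cast hm
  set F := secondTruncMoment (3 * (1 + δ)) with hF
  set G := firstTruncMoment (3 * (1 + δ)) with hG
  set b : Fin m → ℝ := fun k => trunc (3 * (1 + δ)) (‖inner ℂ u (a k)‖ ^ 2) / m with hb
  have hb0 : ∀ k, 0 ≤ b k := fun k => div_nonneg (trunc_nonneg (by positivity)) hm'.le
  have hTsq : ∀ v, ‖weightedAnalysis a b v‖ ^ 2 =
      (∑ k, trunc (3 * (1 + δ)) (‖inner ℂ u (a k)‖ ^ 2) * ‖inner ℂ v (a k)‖ ^ 2) / m := fun v => by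
    rw [norm_weightedAnalysis_sq a hb0, Finset.sum_div]
    exact Finset.sum_congr rfl fun k _ => by rw [hb]; ring
  have hFG : 1 / 4 ≤ F - G := secondTruncMoment_sub_firstTruncMoment (by linarith)
  have hG0 : 0 ≤ G := firstTruncMoment_nonneg _
  have hF4 : F ≤ 4 := (secondTruncMoment_le (by linarith)).trans (by linarith)
  have hFF : F - secondTruncMoment (3 * (1 - δ)) ≤ 2 * (3 * (1 + δ) - 3 * (1 - δ)) :=
    secondTruncMoment_sub_le (by linarith) (by linarith)
  have hTN : ∀ w ∈ N, ‖weightedAnalysis a b w‖ ^ 2 ≤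
      F * ‖inner ℂ u w‖ ^ 2 + G * (1 - ‖inner ℂ u w‖ ^ 2) + δ := fun w hw => by
    rw [hTsq, div_le_iff₀' hm']
    exact hup w hw
  have hTN3 : ∀ w ∈ N, ‖weightedAnalysis a b w‖ ≤ 3 := fun w hw => by
    have h1 : ‖inner ℂ u w‖ ≤ 1 := by
      simpa [hu, hN1 w hw] using norm_inner_le_norm (𝕜 := ℂ) u w
    have h1' : ‖inner ℂ u w‖ ^ 2 ≤ 1 := pow_le_one₀ (norm_nonneg _) h1
    refine abs_le_of_sq_le_sq' ?_ (by norm_num) |>.2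
    nlinarith [hTN w hw, sq_nonneg ‖inner ℂ u w‖]
  obtain ⟨w, hw, hzw, hTz⟩ := norm_sq_le_of_net (weightedAnalysis a b) hδ.le (by linarith) hN hTN3 hz
  have hzlow : secondTruncMoment (3 * (1 - δ)) - δ ≤ ‖weightedAnalysis a b z‖ ^ 2 := by
    rw [hTsq, le_div_iff₀' hm']
    refine hlow.trans (le_trans ?_ (hmax.trans ?_))
    · gcongr with k
      exact trunc_mono hτ.1 (by positivity)
    · gcongr with k
      exact trunc_mono hτ.2 (by positivity)
  have hsub := norm_inner_sq_sub_le hu hz (hN1 w hw)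
  have hw2 := hTN w hw
  have h8 : (F - G) * (‖inner ℂ u w‖ ^ 2 - ‖inner ℂ u z‖ ^ 2) ≤ 8 * δ := by
    calc _ ≤ (F - G) * (2 * δ) := by
          have := hsub.trans (mul_le_mul_of_nonneg_left hzw zero_le_two)
          gcongr
      _ ≤ 4 * (2 * δ) := by
          gcongr
          linarith
      _ = _ := by ring
  -- The `76` collects `12` from changing the threshold, `1 + 1` from the two concentration errors,
  -- `54` from the net and `8` from replacing `w` by `z`. Dividing by the gap `1/4` gives `304`.
  have h9 : (F - G) * (1 - ‖inner ℂ u z‖ ^ 2) ≤ 76 * δ := by nlinarith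
  by_cases hpos : 0 ≤ 1 - ‖inner ℂ u z‖ ^ 2
  · nlinarith
  · linarith

theorem trunc_mul {ρ : ℝ} (hρ : 0 < ρ) (τ t : ℝ) : trunc (ρ * τ) (ρ * t) = ρ * trunc τ t := by
  unfold trunc
  simp [mul_le_mul_iff_right₀ hρ]

theorem norm_sub_outer_le {n : ℕ} {u z : EuclideanSpace ℂ (Fin n)} {δ ε r ρ : ℝ} (hε0 : 0 < ε)
    (hε1 : ε < 1) (hδ : δ = ε ^ 2 / 10000) (hu : ‖u‖ = 1)
    (hz : ‖z‖ = 1) (hρ : 0 < ρ) (hr : |r - ρ| ≤ 4 * δ * ρ)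
    (huz : 1 - ‖inner ℂ u z‖ ^ 2 ≤ 304 * δ) :
    ‖(r : ℂ) • outer z - (ρ : ℂ) • outer u‖ ≤ ε * ρ := by
  -- The squared distance is at most `2 * 304 * δ`; the denominator `10000` in `δ` makes this less
  -- than `ε² / 16`.
  have h1 : ‖outer z - outer u‖ ≤ ε / 4 := by
    refine abs_le_of_sq_le_sq' ?_ (by positivity) |>.2
    rw [norm_outer_sub_outer_sq, hz, hu]
    nlinarith
  have h2 : (r : ℂ) • outer z - (ρ : ℂ) • outer u =
      ((r - ρ : ℝ) : ℂ) • outer z + (ρ : ℂ) • (outer z - outer u) := by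
    push_cast
    rw [sub_smul, smul_sub]
    abel
  rw [h2]
  calc _ ≤ ‖((r - ρ : ℝ) : ℂ) • outer z‖ + ‖(ρ : ℂ) • (outer z - outer u)‖ := norm_add_le _ _
    _ = |r - ρ| + ρ * ‖outer z - outer u‖ := by
        rw [norm_smul, norm_smul, norm_outer, hz, Complex.norm_real, Complex.norm_real,
          Real.norm_eq_abs, Real.norm_of_nonneg hρ.le]
        ring
    _ ≤ 4 * δ * ρ + ρ * (ε / 4) := by gcongr
    _ ≤ ε * ρ := by
        rw [hδ]
        have : 0 < ε * ρ := by positivity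
        nlinarith

/-- Both `n S` and `A` lie within `δ n m` of `n m`, so they differ by at most `2 δ n m`, while `A ≥
n m / 2`. -/
theorem abs_mul_div_sub_le {n m S A ρ δ : ℝ} (hnm : 0 < n * m) (hδ : 0 < δ) (hδ' : δ ≤ 1 / 2)
    (hρ : 0 < ρ) (hS : |S - m| ≤ m * δ) (hA1 : n * (m * (1 - δ)) ≤ A)
    (hA2 : A ≤ n * (m * (1 + δ))) (hn : 0 < n) : |n * (ρ * S) / A - ρ| ≤ 4 * δ * ρ := by
  obtain ⟨hS1, hS2⟩ := abs_le.1 hS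
  have hA0 : 0 < A := by nlinarith
  have h1 := mul_le_mul_of_nonneg_left hS1 hn.le
  have h2 := mul_le_mul_of_nonneg_left hS2 hn.le
  have e1 : n * S - A ≤ 2 * δ * (n * m) := by linarith
  have e2 : -(2 * δ * (n * m)) ≤ n * S - A := by linarith
  have e3 : 2 * δ * (n * m) ≤ 4 * δ * A := by
    have : n * m * (1 / 2) ≤ A := by nlinarith
    nlinarith
  have e4 : n * (ρ * S) / A - ρ = (n * S - A) / A * ρ := by
    field_simp
  rw [e4, abs_mul, abs_of_pos hρ, abs_div, abs_of_pos hA0]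
  gcongr
  rw [div_le_iff₀ hA0]
  exact (abs_le.2 ⟨e2, e1⟩).trans e3

/-- On the event that the empirical means are close to their expectations, every output of the
truncated spectral initialization is close to the target. -/
theorem norm_sub_outer_le_of_isTruncatedSpectralInit {m n : ℕ} (hm : 0 < m) (hn : 0 < n)
    {ε δ : ℝ} (hε0 : 0 < ε) (hε1 : ε < 1) (hδ : δ = ε ^ 2 / 10000)
    {a : Fin m → EuclideanSpace ℂ (Fin n)} {u x : EuclideanSpace ℂ (Fin n)} (hu : ‖u‖ = 1)
    (hx0 : x ≠ 0) (hx : x = (‖x‖ : ℂ) • u)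
    {N : Set (EuclideanSpace ℂ (Fin n))} (hN1 : ∀ w ∈ N, ‖w‖ = 1)
    (hN : ∀ v, ‖v‖ = 1 → ∃ w ∈ N, ‖v - w‖ ≤ δ)
    (hmean : |∑ k, ‖inner ℂ u (a k)‖ ^ 2 - m| ≤ m * δ)
    (hcoord : ∀ j, |∑ k, ‖a k j‖ ^ 2 - m| ≤ m * δ)
    (hlow : m * (secondTruncMoment (3 * (1 - δ)) - δ) ≤
      ∑ k, trunc (3 * (1 - δ)) (‖inner ℂ u (a k)‖ ^ 2) * ‖inner ℂ u (a k)‖ ^ 2)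
    (hup : ∀ w ∈ N, ∑ k, trunc (3 * (1 + δ)) (‖inner ℂ u (a k)‖ ^ 2) * ‖inner ℂ w (a k)‖ ^ 2 ≤
      m * (secondTruncMoment (3 * (1 + δ)) * ‖inner ℂ u w‖ ^ 2 +
        firstTruncMoment (3 * (1 + δ)) * (1 - ‖inner ℂ u w‖ ^ 2) + δ))
    {Z₀ : Matrix (Fin n) (Fin n) ℂ}
    (hZ : IsTruncatedSpectralInit a (sampling a (outer x)) Z₀) :
    ‖Z₀ - outer x‖ ≤ ε * ‖outer x‖ := by
  obtain ⟨z, hz, rfl⟩ := hZ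
  have hm' : (0 : ℝ) < m := by exact_mod_cast hm
  have hn' : (0 : ℝ) < n := by exact_mod_cast hn
  have hδ0 : 0 < δ := by rw [hδ]; positivity
  have hδ1 : δ ≤ 1 / 10000 := by rw [hδ]; nlinarith
  have hxn : 0 < ‖x‖ := norm_pos_iff.2 hx0
  set ρ := ‖x‖ ^ 2 with hρ
  have hρ0 : 0 < ρ := by positivity
  set S := ∑ k, ‖inner ℂ u (a k)‖ ^ 2 with hS
  have hy : ∀ k, sampling a (outer x) k = ρ * ‖inner ℂ u (a k)‖ ^ 2 := fun k => by
    rw [sampling_outer, hx, inner_smul_left, norm_mul, mul_pow, RCLike.norm_conj, Complex.norm_real,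
      norm_norm]
  have hl1 : l1Norm (sampling a (outer x)) = ρ * S := by
    rw [l1Norm, hS, Finset.mul_sum]
    refine Finset.sum_congr rfl fun k _ => ?_
    rw [hy, abs_of_nonneg (by positivity)]
  have hS0 : 0 ≤ S := Finset.sum_nonneg fun k _ => by positivity
  obtain ⟨hS1, hS2⟩ := abs_le.1 hmean
  clear_value S
  have hτ : 3 / m * S ∈ Set.Icc (3 * (1 - δ)) (3 * (1 + δ)) := by
    rw [div_mul_eq_mul_div]
    constructor
    · rw [le_div_iff₀ hm']; linarith
    · rw [div_le_iff₀ hm']; linarith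
  have hform : ∀ v, (inner ℂ v (Matrix.toEuclideanLin
      (truncatedMatrix a (sampling a (outer x))) v)).re =
      ρ / m * ∑ k, trunc (3 / m * S) (‖inner ℂ u (a k)‖ ^ 2) * ‖inner ℂ v (a k)‖ ^ 2 := by
    intro v
    have h : ∀ k, trunc (3 / m * (ρ * S)) (sampling a (outer x) k) =
        ρ * trunc (3 / m * S) (‖inner ℂ u (a k)‖ ^ 2) := fun k => by
      rw [hy, mul_left_comm, trunc_mul hρ0]
    rw [inner_truncatedMatrix_apply, Complex.ofReal_re, hl1]
    simp_rw [h, mul_assoc]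
    rw [← Finset.mul_sum]
    ring
  have hmax := hz.re_inner_le (truncatedMatrix_isHermitian a _) hu
  rw [hform, hform, mul_le_mul_iff_right₀ (by positivity)] at hmax
  have huz := one_sub_norm_inner_sq_le hm hδ0 (by linarith) hτ hu hz.1 hN1 hN hlow hup hmax
  have hA : ∑ i, ‖a i‖ ^ 2 = ∑ j, ∑ k, ‖a k j‖ ^ 2 := by
    simp_rw [EuclideanSpace.norm_sq_eq]
    exact Finset.sum_comm
  have hA1 : n * (m * (1 - δ)) ≤ ∑ i, ‖a i‖ ^ 2 := by
    rw [hA]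
    calc n * (m * (1 - δ)) = ∑ _j : Fin n, (m * (1 - δ)) := by simp
      _ ≤ _ := Finset.sum_le_sum fun j _ => by linarith [(abs_le.1 (hcoord j)).1]
  have hA2 : ∑ i, ‖a i‖ ^ 2 ≤ n * (m * (1 + δ)) := by
    rw [hA]
    calc _ ≤ ∑ _j : Fin n, (m * (1 + δ)) :=
          Finset.sum_le_sum fun j _ => by linarith [(abs_le.1 (hcoord j)).2]
      _ = _ := by simp
  have hA0 : 0 < ∑ i, ‖a i‖ ^ 2 := lt_of_lt_of_le
    (mul_pos hn' (mul_pos hm' (by linarith))) hA1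
  have hxu : outer x = (ρ : ℂ) • outer u := by
    conv_lhs => rw [hx]
    rw [outer_real_smul]
  have hr := abs_mul_div_sub_le (n := n) (m := m) (by positivity) hδ0 (by linarith) hρ0 hmean
    hA1 hA2 hn'
  have hr0 : 0 ≤ n * (ρ * S) / ∑ i, ‖a i‖ ^ 2 :=
    div_nonneg (mul_nonneg hn'.le (mul_nonneg hρ0.le hS0)) hA0.le
  rw [norm_outer, hl1, outer_real_smul, Real.sq_sqrt hr0, hxu]
  exact norm_sub_outer_le hε0 hε1 hδ hu hz.1 hρ0 hr huz

/-! ### Union bound over the bad events -/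

/-- Counts the bad events: three at `u`, two for each of the `n` coordinates, one for each of the at
most `C` net points. The total must be a pure `n`-th power to be absorbed by `exp (-c m)`. -/
theorem three_add_le_pow {n : ℕ} (hn : 0 < n) {K C : ℝ} (hK : 0 ≤ K) (hC : C ≤ K ^ n) :
    3 + 2 * n + C ≤ (5 + K) ^ n := by
  have h1 := one_add_mul_le_pow (a := (4 : ℝ)) (by norm_num) n
  have h2 := pow_add_pow_le (by norm_num : (0 : ℝ) ≤ 5) hK hn.ne'
  have h3 : (1 : ℝ) ≤ n := by exact_mod_cast hn
  norm_num at h1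
  linarith

theorem one_sub_le_measureReal_of_union_eq_univ {Ω : Type*} [MeasurableSpace Ω] {μ : Measure Ω}
    [IsProbabilityMeasure μ] {A B : Set Ω} (h : ∀ ω, ω ∉ B → ω ∈ A) :
    1 - μ.real B ≤ μ.real A := by
  have hu : A ∪ B = Set.univ := Set.eq_univ_of_forall fun ω => by
    by_cases hω : ω ∈ B
    exacts [Or.inr hω, Or.inl (h ω hω)]
  have := measureReal_union_le (μ := μ) A B
  rw [hu, probReal_univ] at this
  linarith

/-- With overwhelming probability the empirical means entering the analysis of the truncated spectral
initialization are close to their expectations. -/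
theorem exists_one_sub_le_measureReal {ε δ : ℝ} (hε0 : 0 < ε) (hε1 : ε < 1)
    (hδ : δ = ε ^ 2 / 10000) :
    ∃ c : ℝ, 0 < c ∧ ∀ {m n : ℕ} {Ω : Type*} [MeasurableSpace Ω] (μ : Measure Ω)
      [IsProbabilityMeasure μ] (a : Fin m → Ω → EuclideanSpace ℂ (Fin n)),
      IsGaussianModel a μ → 0 < m → 0 < n → ∀ x : EuclideanSpace ℂ (Fin n), x ≠ 0 →
      1 - (5 + (1 + 2 / δ) ^ 2) ^ n * Real.exp (-c * m) ≤
        μ.real {ω | ∀ Z₀ : Matrix (Fin n) (Fin n) ℂ,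
          IsTruncatedSpectralInit (fun k => a k ω) (sampling (fun k => a k ω) (outer x)) Z₀ →
            ‖Z₀ - outer x‖ ≤ ε * ‖outer x‖} := by
  have hδ0 : 0 < δ := by rw [hδ]; positivity
  have hδ1 : δ ≤ 1 / 10000 := by rw [hδ]; nlinarith
  obtain ⟨c, hc, H⟩ := exists_measureReal_le_exp hδ0
  refine ⟨c, hc, fun {m n Ω} _ μ _ a ha hm hn x hx0 => ?_⟩
  have hxn : ‖x‖ ≠ 0 := norm_ne_zero_iff.2 hx0
  obtain ⟨u, hu, hxu⟩ : ∃ u : EuclideanSpace ℂ (Fin n), ‖u‖ = 1 ∧ x = (‖x‖ : ℂ) • u := by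
    refine ⟨(‖x‖ : ℂ)⁻¹ • x, ?_, ?_⟩
    · rw [norm_smul, norm_inv, Complex.norm_real, norm_norm, inv_mul_cancel₀ hxn]
    · rw [smul_smul, mul_inv_cancel₀ (by exact_mod_cast hxn), one_smul]
  obtain ⟨N, hN1, hN2, hN3⟩ := exists_finset_net_sphere (E := EuclideanSpace ℂ (Fin n)) hδ0
  -- The net is bounded through the real dimension `2 n`, whence the square in `(1 + 2 / δ) ^ 2`.
  have hfin : Module.finrank ℝ (EuclideanSpace ℂ (Fin n)) = 2 * n := by
    rw [← Module.finrank_mul_finrank ℝ ℂ, Complex.finrank_real_complex]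
    simp
  rw [hfin, pow_mul] at hN3
  -- Coordinates are inner products with unit vectors, so `∑ ‖a_k‖²` is controlled by `n`
  -- applications of the one-direction bound.
  let e : Fin n → EuclideanSpace ℂ (Fin n) := fun j => EuclideanSpace.single j 1
  have he : ∀ j, ‖e j‖ = 1 := fun j => by simp [e]
  have hecoord : ∀ j (z : EuclideanSpace ℂ (Fin n)), inner ℂ (e j) z = z j := fun j z => by
    simp [e, EuclideanSpace.inner_single_left]
  have htm : ∀ τ, Measurable fun z : EuclideanSpace ℂ (Fin n) =>
      trunc τ (‖inner ℂ u z‖ ^ 2) := fun τ => (measurable_trunc τ).comp (by fun_prop)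
  have hsq : ∀ v : EuclideanSpace ℂ (Fin n), ‖v‖ = 1 →
      ∫ z, ‖inner ℂ v z‖ ^ 2 ∂complexGaussian n = 1 := fun v hv => by
    rw [integral_comp_inner hv (f := fun z => ‖z‖ ^ 2) (by fun_prop),
      integral_norm_sq_stdComplexGaussian]
  have hupper : ∀ v, ‖v‖ = 1 →
      μ.real {ω | (m : ℝ) * (1 + δ) ≤ ∑ k, ‖inner ℂ v (a k ω)‖ ^ 2} ≤ Real.exp (-c * m) :=
    fun v hv => H μ a ha v (fun z => ‖inner ℂ v z‖ ^ 2) 1 hv (by fun_prop)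
      (fun z => by rw [abs_of_nonneg (by positivity)]; linarith [sq_nonneg ‖inner ℂ v z‖])
      (hsq v hv).le
  have hlower : ∀ v, ‖v‖ = 1 →
      μ.real {ω | (m : ℝ) * (-1 + δ) ≤ ∑ k, -‖inner ℂ v (a k ω)‖ ^ 2} ≤ Real.exp (-c * m) :=
    fun v hv => H μ a ha v (fun z => -‖inner ℂ v z‖ ^ 2) (-1) hv (by fun_prop)
      (fun z => by
        rw [abs_neg, abs_of_nonneg (by positivity)]; linarith [sq_nonneg ‖inner ℂ v z‖])
      (by rw [integral_neg, hsq v hv])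
  -- Both thresholds `3 (1 ± δ)` are at most `4`, the constant in the growth hypothesis of the
  -- Chernoff bound.
  have htrunc : ∀ {τ : ℝ}, 0 ≤ τ → τ ≤ 4 → ∀ v z : EuclideanSpace ℂ (Fin n),
      |trunc τ (‖inner ℂ u z‖ ^ 2) * ‖inner ℂ v z‖ ^ 2| ≤ 4 * ‖inner ℂ v z‖ ^ 2 :=
    fun {τ} h0 h4 v z => by
      rw [abs_of_nonneg (mul_nonneg (trunc_nonneg (by positivity)) (by positivity))]
      gcongr
      exact (trunc_le h0).trans h4
  have huu : ‖inner ℂ u u‖ ^ 2 = 1 := by rw [inner_self_eq_norm_sq_to_K, hu]; simp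
  have hlow : μ.real {ω | (m : ℝ) * (-secondTruncMoment (3 * (1 - δ)) + δ) ≤
      ∑ k, -(trunc (3 * (1 - δ)) (‖inner ℂ u (a k ω)‖ ^ 2) * ‖inner ℂ u (a k ω)‖ ^ 2)} ≤
        Real.exp (-c * m) :=
    H μ a ha u (fun z => -(trunc (3 * (1 - δ)) (‖inner ℂ u z‖ ^ 2) * ‖inner ℂ u z‖ ^ 2)) _ hu
      ((htm _).mul (by fun_prop)).neg
      (fun z => by rw [abs_neg]; exact htrunc (by linarith) (by linarith) u z)
      (by
        rw [integral_neg, integral_trunc_mul_norm_inner_sq hu hu (by linarith), huu]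
        linarith)
  have hup : ∀ w ∈ N, μ.real {ω | (m : ℝ) * (secondTruncMoment (3 * (1 + δ)) * ‖inner ℂ u w‖ ^ 2 +
        firstTruncMoment (3 * (1 + δ)) * (1 - ‖inner ℂ u w‖ ^ 2) + δ) ≤
      ∑ k, trunc (3 * (1 + δ)) (‖inner ℂ u (a k ω)‖ ^ 2) * ‖inner ℂ w (a k ω)‖ ^ 2} ≤
        Real.exp (-c * m) := fun w hw =>
    H μ a ha w (fun z => trunc (3 * (1 + δ)) (‖inner ℂ u z‖ ^ 2) * ‖inner ℂ w z‖ ^ 2) _ (hN1 w hw)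
      ((htm _).mul (by fun_prop)) (htrunc (by linarith) (by linarith) w)
      (integral_trunc_mul_norm_inner_sq hu (hN1 w hw) (by linarith)).le
  set Bup : EuclideanSpace ℂ (Fin n) → Set Ω := fun v =>
    {ω | (m : ℝ) * (1 + δ) ≤ ∑ k, ‖inner ℂ v (a k ω)‖ ^ 2} with hBup
  set Blo : EuclideanSpace ℂ (Fin n) → Set Ω := fun v =>
    {ω | (m : ℝ) * (-1 + δ) ≤ ∑ k, -‖inner ℂ v (a k ω)‖ ^ 2} with hBlo
  set B : Set Ω := {ω | (m : ℝ) * (-secondTruncMoment (3 * (1 - δ)) + δ) ≤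
      ∑ k, -(trunc (3 * (1 - δ)) (‖inner ℂ u (a k ω)‖ ^ 2) * ‖inner ℂ u (a k ω)‖ ^ 2)} with hB
  set BN : EuclideanSpace ℂ (Fin n) → Set Ω := fun w =>
    {ω | (m : ℝ) * (secondTruncMoment (3 * (1 + δ)) * ‖inner ℂ u w‖ ^ 2 +
        firstTruncMoment (3 * (1 + δ)) * (1 - ‖inner ℂ u w‖ ^ 2) + δ) ≤
      ∑ k, trunc (3 * (1 + δ)) (‖inner ℂ u (a k ω)‖ ^ 2) * ‖inner ℂ w (a k ω)‖ ^ 2} with hBN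
  have hbad : μ.real (((Bup u ∪ Blo u) ∪ B) ∪ (⋃ w ∈ N, BN w) ∪
      ⋃ j ∈ (Finset.univ : Finset (Fin n)), (Bup (e j) ∪ Blo (e j))) ≤
      (5 + (1 + 2 / δ) ^ 2) ^ n * Real.exp (-c * m) := by
    have hnet : μ.real (⋃ w ∈ N, BN w) ≤ N.card * Real.exp (-c * m) :=
      (measureReal_biUnion_finset_le _ _).trans ((Finset.sum_le_sum hup).trans_eq (by simp))
    have hco : μ.real (⋃ j ∈ (Finset.univ : Finset (Fin n)), (Bup (e j) ∪ Blo (e j))) ≤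
        n * (2 * Real.exp (-c * m)) :=
      calc _ ≤ ∑ j : Fin n, μ.real (Bup (e j) ∪ Blo (e j)) := measureReal_biUnion_finset_le _ _
        _ ≤ ∑ _j : Fin n, (Real.exp (-c * m) + Real.exp (-c * m)) :=
          Finset.sum_le_sum fun j _ => (measureReal_union_le _ _).trans
            (add_le_add (hupper _ (he j)) (hlower _ (he j)))
        _ = _ := by
          rw [Finset.sum_const, Finset.card_univ, Fintype.card_fin, nsmul_eq_mul, two_mul]
    have h3 := three_add_le_pow hn (by positivity) hN3
    have h4 := mul_le_mul_of_nonneg_right h3 (Real.exp_pos (-c * m)).le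
    refine (measureReal_union_le _ _).trans ?_
    have h5 := measureReal_union_le (μ := μ) ((Bup u ∪ Blo u) ∪ B) (⋃ w ∈ N, BN w)
    have h6 := measureReal_union_le (μ := μ) (Bup u ∪ Blo u) B
    have h7 := measureReal_union_le (μ := μ) (Bup u) (Blo u)
    have h8 := hupper u hu
    have h9 := hlower u hu
    linarith
  refine le_trans (by linarith) (one_sub_le_measureReal_of_union_eq_univ (B := _) ?_)
  intro ω hω Z₀ hZ
  simp only [Set.mem_union, Set.mem_iUnion, not_or, not_exists, Finset.mem_univ, true_imp_iff,
    hBup, hBlo, hB, hBN, Set.mem_ofPred_eq, not_le, Finset.sum_neg_distrib] at hω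
  obtain ⟨⟨⟨⟨h1, h2⟩, h3⟩, h4⟩, h5⟩ := hω
  refine norm_sub_outer_le_of_isTruncatedSpectralInit hm hn hε0 hε1 hδ hu hx0 hxu
    (N := (N : Set _)) (fun w hw => hN1 w hw) hN2 ?_ (fun j => ?_) ?_ (fun w hw => ?_) hZ
  · rw [abs_le]
    constructor <;> linarith
  · obtain ⟨h6, h7⟩ := h5 j
    simp_rw [hecoord] at h6 h7
    rw [abs_le]
    constructor <;> linarith
  · linarith
  · exact (h4 w hw).le

theorem IsTruncatedSpectralInit.eq_zero {m n : ℕ} {a : Fin m → EuclideanSpace ℂ (Fin n)}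
    {Z₀ : Matrix (Fin n) (Fin n) ℂ} (h : IsTruncatedSpectralInit a (sampling a 0) Z₀) :
    Z₀ = 0 := by
  obtain ⟨z, -, rfl⟩ := h
  simp [l1Norm, sampling, outer_zero]

end PhaseRetrieval

/-! ### Choice of constants and degenerate cases -/

theorem mainTheorem5 (ε₀ : ℝ) (hε₀ : ε₀ ∈ Set.Ioo (0 : ℝ) 1) :
    ∃ c₁ c₂ : ℝ, 0 < c₁ ∧ 0 < c₂ ∧
      ∀ (m n : ℕ), c₁ * (n : ℝ) ≤ (m : ℝ) →
      ∀ (x : EuclideanSpace ℂ (Fin n))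
        (Ω : Type*) [MeasurableSpace Ω] (μ : Measure Ω) [IsProbabilityMeasure μ]
        (a : Fin m → Ω → EuclideanSpace ℂ (Fin n)), PhaseRetrieval.IsGaussianModel a μ →
        1 - Real.exp (-c₂ * (m : ℝ)) ≤
          μ.real {ω | ∀ Z₀ : Matrix (Fin n) (Fin n) ℂ,
            PhaseRetrieval.IsTruncatedSpectralInit (fun k => a k ω)
              (PhaseRetrieval.sampling (fun k => a k ω) (PhaseRetrieval.outer x)) Z₀ →
            ‖Z₀ - PhaseRetrieval.outer x‖ ≤ ε₀ * ‖PhaseRetrieval.outer x‖} := by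
  obtain ⟨hε0, hε1⟩ := hε₀
  set δ := ε₀ ^ 2 / 10000 with hδ
  have hδ0 : 0 < δ := by positivity
  obtain ⟨c, hc, H⟩ := PhaseRetrieval.exists_one_sub_le_measureReal hε0 hε1 hδ
  set K := 5 + (1 + 2 / δ) ^ 2 with hK
  have hK1 : 1 < K := by
    have : 0 ≤ (1 + 2 / δ) ^ 2 := by positivity
    linarith
  have hlog : 0 < Real.log K := Real.log_pos hK1
  -- With this `c₁`, `K ^ n ≤ exp (c m / 2)`: half of the exponent pays for the union bound and the
  -- other half is `c₂`. The cases `n = 0` and `x = 0` hold surely, and otherwise `m > 0` follows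
  -- from `log K > 0`.
  refine ⟨2 * Real.log K / c, c / 2, by positivity, by positivity,
    fun m n hmn x Ω _ μ _ a ha => ?_⟩
  have htriv : ∀ {s : Set Ω}, (∀ ω, ω ∈ s) → 1 - Real.exp (-(c / 2) * m) ≤ μ.real s := fun hs => by
    rw [Set.eq_univ_of_forall hs, probReal_univ]
    linarith [Real.exp_pos (-(c / 2) * m)]
  rcases Nat.eq_zero_or_pos n with rfl | hn
  · refine htriv fun ω Z₀ _ => ?_
    rw [Subsingleton.elim Z₀ 0, Subsingleton.elim (PhaseRetrieval.outer x) 0]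
    simp
  rcases eq_or_ne x 0 with rfl | hx
  · refine htriv fun ω Z₀ hZ => ?_
    rw [PhaseRetrieval.outer_zero] at hZ ⊢
    rw [hZ.eq_zero]
    simp
  have hn' : (0 : ℝ) < n := by exact_mod_cast hn
  have hm : 0 < m := by
    have : (0 : ℝ) < m := lt_of_lt_of_le (by positivity) hmn
    exact_mod_cast this
  refine le_trans ?_ (H μ a ha hm hn x hx)
  have hexp : K ^ n * Real.exp (-c * m) ≤ Real.exp (-(c / 2) * m) := by
    rw [← Real.exp_log (zero_lt_one.trans hK1), ← Real.exp_nat_mul, ← Real.exp_add,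
      Real.exp_le_exp]
    rw [div_mul_eq_mul_div, div_le_iff₀ hc] at hmn
    linarith
  linarith
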